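/- Let $l>0$ and let $V\in L^2[0,l]$ be real-valued. Let $D$ be the Dirichlet operator in $L^2[0,l]$, $Df=-f''+Vf$, $\operatorname{dom}D=\{f\in H^2[0,l]: f(0)=f(l)=0\}$, and let $\mu_0<\mu_1<\mu_2<\dots$ be its eigenvalues (they are real and form such an infinite sequence). For $z\in\mathbb C\setminus\operatorname{spec}D$ let the Krein matrix $s(z)=(s_{jk}(z))_{j,k=1,2}$ be the (well-defined) complex $2\times2$ matrix such that $$\begin{pmatrix} f'(0)\\ -f'(l)\end{pmatrix}=s(z)\begin{pmatrix} f(0)\\ f(l)\end{pmatrix}$$ for every $f\in H^2[0,l]$ with $-f''+Vf=zf$. For $\alpha\in\mathbb R$ and $\beta\in\mathbb R\setminus\{0\}$ let $$P=-\frac{d^2}{dt^2}+W+\frac{\alpha}{1+\beta^2}\sum_{k\in\mathbb Z}\delta(\,\cdot\,-kl),$$ where $W$ is the $l$-periodic extension of $V|_{[0,l)}$ to $\mathbb R$; that is, $P$ acts as $f\mapsto -f''+Wf$ on functions that are $H^2$ on each cell $[kl,(k+1)l]$ and satisfy $f(kl+)=f(kl-)$ and $f'(kl+)=f'(kl-)+\frac{\alpha}{1+\beta^2}f(kl)$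 for all $k\in\mathbb Z$. Its discriminant at $z\in\mathbb C$ is $y_1'(l+;z)+y_2(l+;z)$, where $y_1,y_2$ are the solutions on $\mathbb R$ of $(P-z)y=0$ (with no integrability at infinity required) with $y_1(0+;z)=y_2'(0+;z)=0$ and $y_1'(0+;z)=y_2(0+;z)=1$. Then: (A) $s_{12}(z)\neq0$ for all $z\in\mathbb C\setminus\operatorname{spec}D$. (B) For all $\alpha\in\mathbb R$ and $\beta\in\mathbb R\setminus\{0\}$ the function $$\eta(z)=\frac{\alpha}{s_{12}(z)}-(1+\beta^2)\,\frac{s_{11}(z)+s_{22}(z)}{s_{12}(z)},\qquad z\in\mathbb C\setminus\operatorname{spec}D,$$ extends to an entire function, again denoted by $\eta$. (C) $\frac1{1+\beta^2}\,\eta(z)$ is the discriminant of $P$ at $z$, for every $z\in\mathbb C$. (D) $\eta$ is real on the real axis, $\eta(\mu_k)\le-2(1+\beta^2)$ for even $k$, and $\eta(\mu_k)\ge2(1+\beta^2)$ for odd $k$. (E) $\eta'(z)\neq0$ for every real $z$ with $|\eta(z)|<2(1+\beta^2)$. Moreover, the restriction of $\eta$ to the real axis has no local minimum with value $2(1+\beta^2)$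 and no local maximum with value $-2(1+\beta^2)$. -/

import Mathlib

open MeasureTheory

noncomputable section

namespace KreinKP

/-- The function `y` belongs to the Sobolev space `H²[a,b]`, with first derivative `p` on `[a,b]`
(one-sided at the end points) and second weak derivative `g`: `y` is differentiable with
derivative `p`, and `p` is absolutely continuous with derivative `g ∈ L²`. -/
structure IsH2 (a b : ℝ) (y p g : ℝ → ℂ) : Prop where
  memLp : MemLp g 2 (volume.restrict (Set.Icc a b))
  hasDeriv : ∀ t ∈ Set.Icc a b, HasDerivWithinAt y (p t) (Set.Icc a b) t
  deriv_eq : ∀ t ∈ Set.Icc a b, p t = p a + ∫ s in a..t, g s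

theorem IsH2.zero (a b : ℝ) : IsH2 a b (fun _ => 0) (fun _ => 0) (fun _ => 0) where
  memLp := MemLp.zero'
  hasDeriv := fun t _ => hasDerivWithinAt_const t _ 0
  deriv_eq := by simp

theorem IsH2.intervalIntegrable {a b : ℝ} {y p g : ℝ → ℂ} (h : IsH2 a b y p g) {t : ℝ}
    (ht : t ∈ Set.Icc a b) : IntervalIntegrable g volume a t := by
  have h1 : IntegrableOn g (Set.Icc a b) volume := h.memLp.integrable (by norm_num)
  rw [intervalIntegrable_iff_integrableOn_Icc_of_le ht.1]
  exact h1.mono_set (Set.Icc_subset_Icc_right ht.2)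

theorem IsH2.add {a b : ℝ} {y p g y' p' g' : ℝ → ℂ} (h : IsH2 a b y p g)
    (h' : IsH2 a b y' p' g') : IsH2 a b (y + y') (p + p') (g + g') where
  memLp := h.memLp.add h'.memLp
  hasDeriv := fun t ht => (h.hasDeriv t ht).add (h'.hasDeriv t ht)
  deriv_eq := fun t ht => by
    simp only [Pi.add_apply]
    rw [intervalIntegral.integral_add (h.intervalIntegrable ht) (h'.intervalIntegrable ht),
      h.deriv_eq t ht, h'.deriv_eq t ht]
    ring

theorem IsH2.smul {a b : ℝ} {y p g : ℝ → ℂ} (c : ℂ) (h : IsH2 a b y p g) :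
    IsH2 a b (c • y) (c • p) (c • g) where
  memLp := h.memLp.const_smul c
  hasDeriv := fun t ht => (h.hasDeriv t ht).const_smul c
  deriv_eq := fun t ht => by
    simp only [Pi.smul_apply]
    rw [intervalIntegral.integral_smul, h.deriv_eq t ht, smul_add]

/-- The Hilbert space `L²[0,l]` of complex-valued functions. -/
abbrev L2 (l : ℝ) : Type := Lp ℂ 2 (volume.restrict (Set.Icc (0 : ℝ) l))

/-- The graph of the Dirichlet operator `D f = -f'' + V f`,
`dom D = {f ∈ H²[0,l] : f(0) = f(l) = 0}`, in `L²[0,l]`. -/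
def dirichletGraph (l : ℝ) (V : ℝ → ℝ) : Submodule ℂ (L2 l × L2 l) where
  carrier := {uv | ∃ y p g : ℝ → ℂ, IsH2 0 l y p g ∧ y 0 = 0 ∧ y l = 0 ∧
    (uv.1 : ℝ → ℂ) =ᵐ[volume.restrict (Set.Icc 0 l)] y ∧
    (uv.2 : ℝ → ℂ) =ᵐ[volume.restrict (Set.Icc 0 l)] fun t => -g t + (V t : ℂ) * y t}
  zero_mem' := by
    refine ⟨_, _, _, IsH2.zero 0 l, rfl, rfl, ?_, ?_⟩
    · exact Lp.coeFn_zero _ _ _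
    · filter_upwards [Lp.coeFn_zero ℂ 2 (volume.restrict (Set.Icc (0 : ℝ) l))] with t ht
      simpa using ht
  add_mem' := by
    rintro ⟨u, v⟩ ⟨u', v'⟩ ⟨y, p, g, h, h0, hl, hu, hv⟩ ⟨y', p', g', h', h0', hl', hu', hv'⟩
    refine ⟨_, _, _, h.add h', by simp [h0, h0'], by simp [hl, hl'], ?_, ?_⟩
    · filter_upwards [Lp.coeFn_add u u', hu, hu'] with t h1 h2 h3
      simp only [Prod.fst_add, Pi.add_apply] at *
      rw [h1, h2, h3]
    · filter_upwards [Lp.coeFn_add v v', hv, hv'] with t h1 h2 h3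
      simp only [Prod.snd_add, Pi.add_apply] at *
      rw [h1, h2, h3]
      ring
  smul_mem' := by
    rintro c ⟨u, v⟩ ⟨y, p, g, h, h0, hl, hu, hv⟩
    refine ⟨_, _, _, h.smul c, by simp [h0], by simp [hl], ?_, ?_⟩
    · filter_upwards [Lp.coeFn_smul c u, hu] with t h1 h2
      simp only [Prod.smul_fst, Pi.smul_apply] at *
      rw [h1, h2]
    · filter_upwards [Lp.coeFn_smul c v, hv] with t h1 h2
      simp only [Prod.smul_snd, Pi.smul_apply, smul_eq_mul] at *
      rw [h1, h2]
      ring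

/-- The Dirichlet operator `D` as an unbounded operator in `L²[0,l]`. -/
def dirichletOp (l : ℝ) (V : ℝ → ℝ) : L2 l →ₗ.[ℂ] L2 l := (dirichletGraph l V).toLinearPMap

theorem dirichletGraph_functional {l : ℝ} (hl : 0 < l) (V : ℝ → ℝ) :
    ∀ x ∈ dirichletGraph l V, x.1 = 0 → x.2 = 0 := by
  rintro ⟨u, v⟩ ⟨y, p, g, h, -, -, hu, hv⟩ (rfl : u = 0)
  have hyc : ContinuousOn y (Set.Icc 0 l) := fun t ht => (h.hasDeriv t ht).continuousWithinAt
  have hy0 : y =ᵐ[volume.restrict (Set.Icc 0 l)] (fun _ => (0 : ℂ)) := by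
    filter_upwards [hu, Lp.coeFn_zero ℂ 2 (volume.restrict (Set.Icc (0 : ℝ) l))] with t h1 h2
    rw [← h1]
    simpa using h2
  have hy : Set.EqOn y (fun _ => (0 : ℂ)) (Set.Icc 0 l) :=
    Measure.eqOn_Icc_of_ae_eq volume hl.ne hy0 hyc continuousOn_const
  have hp : ∀ t ∈ Set.Icc 0 l, p t = 0 := fun t ht =>
    (uniqueDiffOn_Icc hl t ht).eq_deriv _ (h.hasDeriv t ht)
      ((hasDerivWithinAt_const t _ (0 : ℂ)).congr hy (hy ht))
  have hint : ∀ t ∈ Set.Icc 0 l, ∫ s in (0 : ℝ)..t, g s = 0 := fun t ht => by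
    have := h.deriv_eq t ht
    rw [hp t ht, hp 0 ⟨le_rfl, hl.le⟩] at this
    simpa using this.symm
  have hg : g =ᵐ[volume.restrict (Set.Icc 0 l)] 0 := by
    have hd := (h.intervalIntegrable ⟨hl.le, le_rfl⟩).ae_hasDerivAt_integral
    rw [← restrict_Ioo_eq_restrict_Icc]
    refine (ae_restrict_iff' measurableSet_Ioo).2 ?_
    filter_upwards [hd] with t ht hmem
    rw [Set.uIcc_of_le hl.le] at ht
    refine (ht ⟨hmem.1.le, hmem.2.le⟩ 0 ⟨le_rfl, hl.le⟩).unique ?_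
    refine (hasDerivAt_const t (0 : ℂ)).congr_of_eventuallyEq ?_
    filter_upwards [Ioo_mem_nhds hmem.1 hmem.2] with x hx
    exact hint x ⟨hx.1.le, hx.2.le⟩
  refine Lp.ext ?_
  filter_upwards [hv, hy0, hg, Lp.coeFn_zero ℂ 2 (volume.restrict (Set.Icc (0 : ℝ) l))]
    with t h1 h2 h3 h4
  rw [h4]
  simpa [h2, h3] using h1

theorem dirichletOp_graph {l : ℝ} (hl : 0 < l) (V : ℝ → ℝ) :
    (dirichletOp l V).graph = dirichletGraph l V :=
  Submodule.toLinearPMap_graph_eq _ (dirichletGraph_functional hl V)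

/-- The spectrum of an unbounded operator `A`: the complement of the set of those `z` for which
`A - z : dom A → H` is bijective with bounded inverse `R`. -/
def spec {H : Type*} [NormedAddCommGroup H] [NormedSpace ℂ H] (A : H →ₗ.[ℂ] H) : Set ℂ :=
  {z | ¬ ∃ R : H →L[ℂ] H, ∀ u f : H, (u, f + z • u) ∈ A.graph ↔ u = R f}

/-- `z` is an eigenvalue of the unbounded operator `A`. -/
def IsEigenvalue {H : Type*} [NormedAddCommGroup H] [NormedSpace ℂ H] (A : H →ₗ.[ℂ] H)
    (z : ℂ) : Prop :=
  ∃ u : A.domain, u ≠ 0 ∧ A u = z • (u : H)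

/-- `y ∈ H²[a,b]`, with first derivative `p`, solves `-y'' + W y = z y` on `[a,b]`. -/
def IsSolution (a b : ℝ) (W : ℝ → ℝ) (z : ℂ) (y p : ℝ → ℂ) : Prop :=
  ∃ g : ℝ → ℂ, IsH2 a b y p g ∧
    ∀ᵐ t ∂(volume.restrict (Set.Icc a b)), -g t + (W t : ℂ) * y t = z * y t

/-- `s` is the value at `z` of the Krein function of the boundary triple
`Γ f = (f(0), f(l))`, `Γ' f = (f'(0), -f'(l))` for `S = -d²/dt² + V` on `H²[0,l]`: the boundary
value problem `(S - z) f = 0`, `Γ f = c` is solvable for every `c`, and `Γ' f = s Γ f` for every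
solution `f` of `(S - z) f = 0`. These conditions determine `s`. -/
def IsKreinMatrix (l : ℝ) (V : ℝ → ℝ) (z : ℂ) (s : Matrix (Fin 2) (Fin 2) ℂ) : Prop :=
  (∀ c : Fin 2 → ℂ, ∃ f p : ℝ → ℂ, IsSolution 0 l V z f p ∧ ![f 0, f l] = c) ∧
  ∀ f p : ℝ → ℂ, IsSolution 0 l V z f p → ![p 0, -p l] = s.mulVec ![f 0, f l]

open Classical in
/-- The Krein matrix `s(z)` (the zero matrix at the points where it is not defined). -/
def kreinMatrix (l : ℝ) (V : ℝ → ℝ) (z : ℂ) : Matrix (Fin 2) (Fin 2) ℂ :=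
  if h : ∃ s, IsKreinMatrix l V z s then h.choose else 0

/-- `α / s₁₂(z) - (1 + β²) (s₁₁(z) + s₂₂(z)) / s₁₂(z)`. -/
def kreinEta (l : ℝ) (V : ℝ → ℝ) (α β : ℝ) (z : ℂ) : ℂ :=
  (α : ℂ) / kreinMatrix l V z 0 1 -
    (1 + (β : ℂ) ^ 2) * ((kreinMatrix l V z 0 0 + kreinMatrix l V z 1 1) / kreinMatrix l V z 0 1)

/-- The `l`-periodic extension `W` of `V|_[0,l)`: `W(t + n l) = V(t)` for `t ∈ [0,l)`, `n ∈ ℤ`. -/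
def periodize (l : ℝ) (V : ℝ → ℝ) (t : ℝ) : ℝ := V (l * Int.fract (t / l))

/-- `y` is a solution on the whole line of `(P - z) y = 0` for the Kronig–Penney operator
`P = -d²/dt² + W + a ∑ₖ δ(t - k l)`, and `p k` is its derivative on the `k`-th cell
`[k l, (k+1) l]`; thus `p k (k l) = y'(k l +)` and `p (k-1) (k l) = y'(k l -)`. The values
`y(k l ±)` agree and are `y (k l)`, because `y` is continuous on each closed cell. -/
structure IsKPSolution (l : ℝ) (V : ℝ → ℝ) (a : ℝ) (z : ℂ) (y : ℝ → ℂ) (p : ℤ → ℝ → ℂ) :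
    Prop where
  cell : ∀ k : ℤ, IsSolution (k * l) ((k + 1) * l) (periodize l V) z y (p k)
  jump : ∀ k : ℤ, p k (k * l) = p (k - 1) (k * l) + (a : ℂ) * y (k * l)

/-- `y₁, y₂` are solutions of `(P - z) y = 0` with `y₁(0+) = y₂'(0+) = 0` and
`y₁'(0+) = y₂(0+) = 1`. -/
structure IsFundamentalPair (l : ℝ) (V : ℝ → ℝ) (a : ℝ) (z : ℂ) (y₁ : ℝ → ℂ) (p₁ : ℤ → ℝ → ℂ)
    (y₂ : ℝ → ℂ) (p₂ : ℤ → ℝ → ℂ) : Prop where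
  sol₁ : IsKPSolution l V a z y₁ p₁
  sol₂ : IsKPSolution l V a z y₂ p₂
  val₁ : y₁ 0 = 0
  der₁ : p₁ 0 0 = 1
  val₂ : y₂ 0 = 1
  der₂ : p₂ 0 0 = 0

/-- `M` is the monodromy matrix of `P` at `z`. -/
def IsMonodromy (l : ℝ) (V : ℝ → ℝ) (a : ℝ) (z : ℂ) (M : Matrix (Fin 2) (Fin 2) ℂ) : Prop :=
  (∃ y₁ p₁ y₂ p₂, IsFundamentalPair l V a z y₁ p₁ y₂ p₂) ∧
  ∀ y₁ p₁ y₂ p₂, IsFundamentalPair l V a z y₁ p₁ y₂ p₂ →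
    M = !![p₁ 1 l, p₂ 1 l; y₁ l, y₂ l]

open Classical in
/-- The monodromy matrix `M(z)` of `P` (the zero matrix if it were not defined). -/
def monodromy (l : ℝ) (V : ℝ → ℝ) (a : ℝ) (z : ℂ) : Matrix (Fin 2) (Fin 2) ℂ :=
  if h : ∃ M, IsMonodromy l V a z M then h.choose else 0

/-- The discriminant (Lyapunov function) `tr M(z)` of `P`. -/
def discriminant (l : ℝ) (V : ℝ → ℝ) (a : ℝ) (z : ℂ) : ℂ := (monodromy l V a z).trace

end KreinKP

end

noncomputable section

namespace KreinKP

open Set Filter Topology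

/-! Let `c`, `s` be the solutions on `[0,l]` with `c(0) = s'(0) = 1`, `c'(0) = s(0) = 0`. As their
Wronskian is 1, the Krein matrix has entries `-c/s`, `1/s`, `1/s`, `-s'/s`, taken at `l`. Hence `s₁₂
= 1/s` never vanishes, and `η = α s + (1+β²)(c + s')` is entire and equals `1+β²` times the trace of
the one-period transfer matrix, which has determinant 1 (`IsFund.kreinEta_eq`,
`IsFund.discriminant_eq`).

The Dirichlet eigenvalues are the zeros of `z ↦ s(l;z)`. There `c s' = 1`, so `|c + s'| ≥ 2` with
the sign of `s'(l)`. By Lagrange's identity `s' ∂s/∂z = ∫ s² > 0` at a zero, so the zeros are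
simple; since `s(l;x) > 0` for very negative `x`, the signs alternate beginning with a minus
(`dirichlet_deriv_mul_pos`, `exists_strictMono_zeros`). There are infinitely many zeros because `k
s(l;k²)` stays close to `sin (k l)` for large `k`.

If the trace lies in `[-2,2]`, the transfer matrix has an eigenvalue of modulus one; the
corresponding Bloch solution has equal boundary forms at both ends, and Lagrange's identity forces
`z` to be real (`IsFund.im_eq_zero_of_trace`). So `η` takes values in `[-2(1+β²), 2(1+β²)]` only on
the real axis. Near a real critical point `η` has local order at least two and so takes nearby real
values at non-real points; this excludes the critical points in (E) (`exists_nonreal_eq_sub`).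

Since `V` is only `L²`, the equation is rewritten with the quasi-derivative `u = y' - Q y`, where
`Q' = V - w` with `w` continuous. This gives a linear system with continuous coefficients, solved by
inverting a Volterra operator that is affine in `z`. -/

theorem differentiable_inverse_one_sub_apply {X : Type*} [NormedAddCommGroup X] [NormedSpace ℂ X]
    [CompleteSpace X] (S T : X →L[ℂ] X) (h : ∀ z : ℂ, IsUnit (1 - (S + z • T))) (x : X) :
    Differentiable ℂ fun z : ℂ => Ring.inverse (1 - (S + z • T)) x := by
  intro z
  have h1 : DifferentiableAt ℂ (fun z : ℂ => 1 - (S + z • T)) z := by fun_prop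
  exact (h1.inverse (h z)).clm_apply (differentiableAt_const _)

/-! ### Linear differential equations through Volterra operators, with analytic dependence on a
parameter. -/

section Volterra

variable {E : Type*} [NormedAddCommGroup E] [NormedSpace ℂ E] {l : ℝ}

theorem continuous_clm_iccExtend (hl : 0 ≤ l) (K : C(ℝ, E →L[ℂ] E)) (f : C(Icc 0 l, E)) :
    Continuous fun s => K s (IccExtend hl f s) :=
  K.continuous.clm_apply (f.continuous.Icc_extend' (h := hl))

theorem exists_bound_Icc (K : C(ℝ, E →L[ℂ] E)) (l : ℝ) :
    ∃ M : ℝ, 0 ≤ M ∧ ∀ s ∈ Icc 0 l, ‖K s‖ ≤ M := by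
  obtain ⟨M, hM⟩ := isCompact_Icc.exists_bound_of_continuousOn
    (K.continuous.continuousOn (s := Icc 0 l))
  exact ⟨max M 0, le_max_right _ _, fun s hs => (hM s hs).trans (le_max_left _ _)⟩

/-- The Volterra operator `f ↦ ∫₀ᵗ K(s) f(s) ds` on `C([0,l], E)`. -/
def volterra (hl : 0 ≤ l) (K : C(ℝ, E →L[ℂ] E)) : C(Icc 0 l, E) →L[ℂ] C(Icc 0 l, E) :=
  LinearMap.mkContinuousOfExistsBound
    { toFun := fun f => ⟨fun t => ∫ s in (0 : ℝ)..t, K s (IccExtend hl f s),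
        (intervalIntegral.continuous_primitive
          (fun a b => (continuous_clm_iccExtend hl K f).intervalIntegrable a b) 0).comp
          continuous_subtype_val⟩
      map_add' := fun f g => by
        ext t
        simp only [ContinuousMap.coe_mk, ContinuousMap.add_apply]
        rw [← intervalIntegral.integral_add
          ((continuous_clm_iccExtend hl K f).intervalIntegrable _ _)
          ((continuous_clm_iccExtend hl K g).intervalIntegrable _ _)]
        simp [IccExtend]
      map_smul' := fun c f => by
        ext t
        simp only [ContinuousMap.coe_mk, ContinuousMap.smul_apply, RingHom.id_apply]
        rw [← intervalIntegral.integral_smul]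
        simp [IccExtend] }
    (by
      obtain ⟨M, hM0, hM⟩ := exists_bound_Icc K l
      refine ⟨M * l, fun f => ?_⟩
      rw [ContinuousMap.norm_le _ (by positivity)]
      intro t
      refine (intervalIntegral.norm_integral_le_of_norm_le_const (C := M * ‖f‖) ?_).trans ?_
      · intro s hs
        rw [uIoc_of_le t.2.1] at hs
        exact (K s).le_of_opNorm_le_of_le (hM s ⟨hs.1.le, hs.2.trans t.2.2⟩)
          (f.norm_coe_le_norm _)
      · rw [sub_zero, abs_of_nonneg t.2.1]
        have := mul_le_mul_of_nonneg_left t.2.2 (by positivity : 0 ≤ M * ‖f‖)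
        linarith)

theorem volterra_apply (hl : 0 ≤ l) (K : C(ℝ, E →L[ℂ] E)) (f : C(Icc 0 l, E)) (t : Icc 0 l) :
    volterra hl K f t = ∫ s in (0 : ℝ)..t, K s (IccExtend hl f s) := rfl

theorem volterra_add_smul (hl : 0 ≤ l) (K N : C(ℝ, E →L[ℂ] E)) (z : ℂ) :
    volterra hl (K + z • N) = volterra hl K + z • volterra hl N := by
  ext f t
  simp only [add_apply, smul_apply,
    ContinuousMap.add_apply, ContinuousMap.smul_apply, volterra_apply]
  rw [← intervalIntegral.integral_smul, ← intervalIntegral.integral_add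
    ((continuous_clm_iccExtend hl K f).intervalIntegrable _ _)
    ((by exact (continuous_clm_iccExtend hl N f).const_smul z :
      Continuous fun s => z • N s (IccExtend hl f s)).intervalIntegrable _ _)]

/-- Each application integrates the previous bound in `t`, which produces the factorial; no
smallness of `l` or `K` is needed. -/
theorem norm_volterra_pow_apply_le (hl : 0 ≤ l) (K : C(ℝ, E →L[ℂ] E)) {M : ℝ}
    (hM : ∀ s ∈ Icc 0 l, ‖K s‖ ≤ M) (f : C(Icc 0 l, E)) (n : ℕ) (t : Icc 0 l) :
    ‖((volterra hl K) ^ n) f t‖ ≤ M ^ n * (t : ℝ) ^ n / n.factorial * ‖f‖ := by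
  induction n generalizing t with
  | zero => simpa using f.norm_coe_le_norm t
  | succ n ih =>
    rw [pow_succ', mul_apply_eq_comp, volterra_apply]
    have hb : ∀ s ∈ Icc (0 : ℝ) t, ‖K s (IccExtend hl (((volterra hl K) ^ n) f) s)‖ ≤
        M ^ (n + 1) / n.factorial * ‖f‖ * s ^ n := by
      intro s hs
      have hs' : s ∈ Icc 0 l := ⟨hs.1, hs.2.trans t.2.2⟩
      rw [IccExtend_of_mem _ _ hs']
      refine ((K s).le_of_opNorm_le_of_le (hM s hs') (ih ⟨s, hs'⟩)).trans (le_of_eq ?_)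
      simp only
      ring
    refine (intervalIntegral.norm_integral_le_of_norm_le t.2.1
      (ae_of_all _ fun s hs => hb s ⟨hs.1.le, hs.2⟩)
      ((by fun_prop : Continuous _).intervalIntegrable _ _)).trans (le_of_eq ?_)
    rw [intervalIntegral.integral_const_mul, integral_pow, Nat.factorial_succ]
    push_cast
    field_simp
    ring

/-- Some power `Tⁿ` has norm below 1, so `1 - Tⁿ = (1 - T) ∑ Tⁱ` is invertible; the factors commute,
so `1 - T` is invertible as well. -/
theorem isUnit_one_sub_volterra [CompleteSpace E] (hl : 0 ≤ l) (K : C(ℝ, E →L[ℂ] E)) :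
    IsUnit (1 - volterra hl K) := by
  obtain ⟨M, hM0, hM⟩ := exists_bound_Icc K l
  have hlim := FloorSemiring.tendsto_pow_div_factorial_atTop (M * l)
  obtain ⟨n, hn⟩ := (hlim.eventually (gt_mem_nhds (zero_lt_one))).exists
  have hnorm : ‖(volterra hl K) ^ n‖ < 1 := by
    refine lt_of_le_of_lt (ContinuousLinearMap.opNorm_le_bound _ (by positivity) fun f => ?_) hn
    rw [ContinuousMap.norm_le _ (by positivity)]
    intro t
    refine (norm_volterra_pow_apply_le hl K hM f n t).trans ?_
    rw [mul_pow]
    have : (t : ℝ) ^ n ≤ l ^ n := pow_le_pow_left₀ t.2.1 t.2.2 n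
    gcongr
  have hu : IsUnit (1 - (volterra hl K) ^ n) :=
    isUnit_one_sub_of_norm_lt_one (R := C(Icc 0 l, E) →L[ℂ] C(Icc 0 l, E)) hnorm
  have hc : Commute (1 - volterra hl K) (∑ i ∈ Finset.range n, (volterra hl K) ^ i) :=
    (Commute.one_left _).sub_left
      (Commute.sum_right _ _ _ fun i _ => (Commute.refl _).pow_right i)
  have := mul_neg_geom_sum (volterra hl K) n
  rw [← this] at hu
  exact (hc.isUnit_mul_iff.1 hu).1

/-- The solution of `Y = v + ∫₀ᵗ K Y` in `C([0,l], E)`. -/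
def volterraSol (hl : 0 ≤ l) (K : C(ℝ, E →L[ℂ] E)) (v : E) : C(Icc 0 l, E) :=
  Ring.inverse (1 - volterra hl K) (ContinuousMap.const _ v)

/-- The solution of `Y' = K Y` on `[0,l]` with `Y(0) = v`, as a function on the line. -/
def linSol (hl : 0 ≤ l) (K : C(ℝ, E →L[ℂ] E)) (v : E) (t : ℝ) : E :=
  v + ∫ s in (0 : ℝ)..t, K s (IccExtend hl (volterraSol hl K v) s)

theorem linSol_zero (hl : 0 ≤ l) (K : C(ℝ, E →L[ℂ] E)) (v : E) : linSol hl K v 0 = v := by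
  simp [linSol]

variable [CompleteSpace E]

theorem volterraSol_eq (hl : 0 ≤ l) (K : C(ℝ, E →L[ℂ] E)) (v : E) :
    volterraSol hl K v = ContinuousMap.const _ v + volterra hl K (volterraSol hl K v) := by
  have h := Ring.mul_inverse_cancel _ (isUnit_one_sub_volterra hl K)
  have h2 := congrArg (fun A => A (ContinuousMap.const (Icc 0 l) v)) h
  simp only [mul_apply_eq_comp, one_apply_eq_self,
    sub_apply] at h2
  exact sub_eq_iff_eq_add.1 h2

theorem linSol_eq (hl : 0 ≤ l) (K : C(ℝ, E →L[ℂ] E)) (v : E) {t : ℝ} (ht : t ∈ Icc 0 l) :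
    linSol hl K v t = volterraSol hl K v ⟨t, ht⟩ := by
  conv_rhs => rw [volterraSol_eq]
  rfl

theorem hasDerivAt_linSol (hl : 0 ≤ l) (K : C(ℝ, E →L[ℂ] E)) (v : E) {t : ℝ}
    (ht : t ∈ Icc 0 l) : HasDerivAt (linSol hl K v) (K t (linSol hl K v t)) t := by
  have hc := continuous_clm_iccExtend hl K (volterraSol hl K v)
  have := (hc.integral_hasStrictDerivAt 0 t).hasDerivAt.const_add v
  rwa [IccExtend_of_mem _ _ ht, ← linSol_eq hl K v ht] at this

/-- The difference of two solutions solves the same linear equation with initial value zero, so it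
vanishes by Gronwall's inequality. -/
theorem eqOn_linSol (hl : 0 ≤ l) (K : C(ℝ, E →L[ℂ] E)) (v : E) {Y : ℝ → E}
    (hY : ∀ t ∈ Icc 0 l, HasDerivWithinAt Y (K t (Y t)) (Icc 0 l) t) (h0 : Y 0 = v) :
    EqOn Y (linSol hl K v) (Icc 0 l) := by
  obtain ⟨M, hM0, hM⟩ := exists_bound_Icc K l
  have hd : ∀ t ∈ Icc 0 l, HasDerivWithinAt (fun s => Y s - linSol hl K v s)
      (K t (Y t - linSol hl K v t)) (Icc 0 l) t := fun t ht => by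
    rw [map_sub]
    exact (hY t ht).sub (hasDerivAt_linSol hl K v ht).hasDerivWithinAt
  intro t ht
  refine sub_eq_zero.1 (eq_zero_of_abs_deriv_le_mul_abs_self_of_eq_zero_right (K := M)
    (f := fun s => Y s - linSol hl K v s) (f' := fun s => K s (Y s - linSol hl K v s))
    (fun s hs => (hd s hs).continuousWithinAt) (fun s hs => ?_) (by simp [h0, linSol_zero])
    (fun s hs => ?_) t ht)
  · exact (hd s ⟨hs.1, hs.2.le⟩).mono_of_mem_nhdsWithin (Icc_mem_nhdsGE_of_mem hs)
  · exact (K s).le_of_opNorm_le (hM s ⟨hs.1, hs.2.le⟩) _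

theorem differentiable_volterraSol (hl : 0 ≤ l) (K N : C(ℝ, E →L[ℂ] E)) (v : E) :
    Differentiable ℂ fun z : ℂ => volterraSol hl (K + z • N) v := by
  have h := differentiable_inverse_one_sub_apply (volterra hl K) (volterra hl N)
    (fun z => by rw [← volterra_add_smul]; exact isUnit_one_sub_volterra hl _)
    (ContinuousMap.const _ v)
  simp only [← volterra_add_smul] at h
  exact h

theorem differentiable_linSol (hl : 0 ≤ l) (K N : C(ℝ, E →L[ℂ] E)) (v : E) {t : ℝ}
    (ht : t ∈ Icc 0 l) : Differentiable ℂ fun z : ℂ => linSol hl (K + z • N) v t := by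
  simp only [linSol_eq hl _ v ht]
  exact (ContinuousMap.evalCLM ℂ (⟨t, ht⟩ : Icc 0 l)).differentiable.comp
    (differentiable_volterraSol hl K N v)

theorem continuous_uncurry_iccExtend_volterraSol (hl : 0 ≤ l) (K N : C(ℝ, E →L[ℂ] E)) (v : E) :
    Continuous fun x : ℂ × ℝ => IccExtend hl (volterraSol hl (K + x.1 • N) v) x.2 := by
  have h := (differentiable_volterraSol hl K N v).continuous
  have h2 : Continuous fun x : ℂ × ℝ => volterraSol hl (K + x.1 • N) v := h.comp continuous_fst
  exact h2.eval (continuous_projIcc.comp continuous_snd)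

end Volterra

/-! ### Product rule for absolutely continuous functions. -/

section ProductRule

theorem intervalIntegrable_ofReal {d : ℝ → ℝ} {a b : ℝ} (hd : IntervalIntegrable d volume a b) :
    IntervalIntegrable (fun t => (d t : ℂ)) volume a b :=
  ⟨Integrable.ofReal hd.1, Integrable.ofReal hd.2⟩

theorem absolutelyContinuousOnInterval_congr {f g : ℝ → ℂ} {a b : ℝ}
    (hf : AbsolutelyContinuousOnInterval f a b) (h : EqOn f g (uIcc a b)) :
    AbsolutelyContinuousOnInterval g a b := by
  unfold AbsolutelyContinuousOnInterval at hf ⊢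
  refine Tendsto.congr' ?_ hf
  rw [EventuallyEq, eventually_inf_principal]
  filter_upwards with x hx
  refine Finset.sum_congr rfl fun i hi => ?_
  rw [h (hx.left i hi).left, h (hx.left i hi).right]

theorem absolutelyContinuousOnInterval_integral {f : ℝ → ℂ} {b : ℝ}
    (hf : IntervalIntegrable f volume 0 b) :
    AbsolutelyContinuousOnInterval (fun t => ∫ s in (0 : ℝ)..t, f s) 0 b := by
  have hre : IntervalIntegrable (fun s => (f s).re) volume 0 b := ⟨hf.1.re, hf.2.re⟩
  have him : IntervalIntegrable (fun s => (f s).im) volume 0 b := ⟨hf.1.im, hf.2.im⟩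
  have h1 := hre.absolutelyContinuousOnInterval_intervalIntegral (c := 0) (by simp)
  have h2 := him.absolutelyContinuousOnInterval_intervalIntegral (c := 0) (by simp)
  have hc : ∀ c : ℂ, AbsolutelyContinuousOnInterval (fun _ : ℝ => c) 0 b := fun c =>
    (contDiffOn_const (c := c)).absolutelyContinuousOnInterval
  refine absolutelyContinuousOnInterval_congr
    ((h1.fun_smul (hc 1)).fun_add (h2.fun_smul (hc Complex.I)))
    fun t ht => ?_
  have hsub : uIcc 0 t ⊆ uIcc 0 b := uIcc_subset_uIcc_left ht
  have e : ∀ s, f s = ((f s).re : ℂ) + ((f s).im : ℂ) * Complex.I := fun s =>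
    (Complex.re_add_im _).symm
  conv_rhs => rw [intervalIntegral.integral_congr (fun s _ => e s)]
  rw [intervalIntegral.integral_add (intervalIntegrable_ofReal (hre.mono_set hsub))
    ((intervalIntegrable_ofReal (him.mono_set hsub)).mul_const _),
    intervalIntegral.integral_mul_const, intervalIntegral.integral_ofReal,
    intervalIntegral.integral_ofReal]
  simp

/-- Product rule for a primitive of an integrable function and a `C¹` function. -/
theorem primitive_mul_eq_integral {b : ℝ} (hb : 0 ≤ b) {d Q : ℝ → ℝ} {y r : ℝ → ℂ}
    (hd : IntervalIntegrable d volume 0 b)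
    (hQ : ∀ t ∈ Icc 0 b, Q t = ∫ s in (0 : ℝ)..t, d s)
    (hy : ∀ t ∈ Icc 0 b, HasDerivWithinAt y (r t) (Icc 0 b) t) (hr : ContinuousOn r (Icc 0 b)) :
    (Q b : ℂ) * y b = ∫ s in (0 : ℝ)..b, ((d s : ℂ) * y s + (Q s : ℂ) * r s) := by
  have hyc : ContinuousOn y (Icc 0 b) := fun t ht => (hy t ht).continuousWithinAt
  have hri : IntervalIntegrable r volume 0 b := by
    apply ContinuousOn.intervalIntegrable; rwa [uIcc_of_le hb]
  have hyint : ∀ t ∈ Icc 0 b, y 0 + ∫ s in (0 : ℝ)..t, r s = y t := fun t ht => by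
    have hsub : Icc 0 t ⊆ Icc 0 b := Icc_subset_Icc_right ht.2
    rw [intervalIntegral.integral_eq_sub_of_hasDerivAt_of_le ht.1 (hyc.mono hsub)
      (fun s hs => (hy s ⟨hs.1.le, hs.2.le.trans ht.2⟩).hasDerivAt
        (Icc_mem_nhds hs.1 (hs.2.trans_le ht.2)))]
    · ring
    · apply ContinuousOn.intervalIntegrable; rw [uIcc_of_le ht.1]; exact hr.mono hsub
  -- `Q` and `y` are controlled only on `[0,b]`; these primitives are defined on the whole line and
  -- have two-sided derivatives almost everywhere on `[0,b]`.
  set Qp : ℝ → ℝ := fun t => ∫ s in (0 : ℝ)..t, d s with hQp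
  set yp : ℝ → ℂ := fun t => y 0 + ∫ s in (0 : ℝ)..t, r s with hyp
  have hQpc : ContinuousOn Qp (Icc 0 b) := by
    have := hd.absolutelyContinuousOnInterval_intervalIntegral (c := 0) (by simp)
    simpa [uIcc_of_le hb] using this.continuousOn
  have hypc : ContinuousOn yp (Icc 0 b) := hyc.congr fun t ht => hyint t ht
  set φ : ℝ → ℂ := fun s => d s • yp s + Qp s • r s with hφ
  have hφi : IntervalIntegrable φ volume 0 b := by
    refine IntervalIntegrable.add ?_ ?_
    · exact hd.smul_continuousOn (by rwa [uIcc_of_le hb])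
    · exact hri.continuousOn_smul (by rwa [uIcc_of_le hb])
  -- This difference is absolutely continuous with derivative zero almost everywhere, hence
  -- constant.
  have hac : AbsolutelyContinuousOnInterval
      (fun t => Qp t • yp t - ∫ s in (0 : ℝ)..t, φ s) 0 b := by
    refine AbsolutelyContinuousOnInterval.fun_sub (AbsolutelyContinuousOnInterval.fun_smul ?_ ?_) ?_
    · exact hd.absolutelyContinuousOnInterval_intervalIntegral (c := 0) (by simp)
    · refine AbsolutelyContinuousOnInterval.fun_add ?_ ?_
      · exact (contDiffOn_const (c := y 0)).absolutelyContinuousOnInterval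
      · exact absolutelyContinuousOnInterval_integral hri
    · exact absolutelyContinuousOnInterval_integral hφi
  obtain ⟨C, hC⟩ := hac.const_of_ae_hasDerivAt_zero (by
    filter_upwards [hd.ae_hasDerivAt_integral, hri.ae_hasDerivAt_integral,
      hφi.ae_hasDerivAt_integral] with t h1 h2 h3 ht
    have e1 := h1 ht 0 (by simp)
    have e2 := (h2 ht 0 (by simp)).const_add (y 0)
    have e3 := h3 ht 0 (by simp)
    refine ((e1.smul e2).sub e3).congr_deriv ?_
    simp only [hφ, hQp, hyp]
    abel)
  have h0 := hC 0 (by simp)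
  have h1 := hC b (by simp)
  rw [← h0] at h1
  simp only [hQp, intervalIntegral.integral_same, zero_smul, sub_zero] at h1
  have hbm : b ∈ Icc 0 b := ⟨hb, le_rfl⟩
  rw [sub_eq_zero, ← hQ b hbm] at h1
  rw [← hyint b hbm, ← Complex.real_smul, h1]
  refine intervalIntegral.integral_congr fun s hs => ?_
  rw [uIcc_of_le hb] at hs
  simp only [hφ, Complex.real_smul, hyp, hyint s hs]
  rw [hQ s hs]

end ProductRule

/-! ### The first-order system for `y` and its quasi-derivative. -/

section System

/-- The first-order system `y' = Q y + u`, `u' = -Q u + (q - z) y` on `[0,l]`. -/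
structure IsSys (l : ℝ) (Q q : C(ℝ, ℝ)) (z : ℂ) (y u : ℝ → ℂ) : Prop where
  deriv_fst : ∀ t ∈ Icc 0 l, HasDerivWithinAt y ((Q t : ℂ) * y t + u t) (Icc 0 l) t
  deriv_snd : ∀ t ∈ Icc 0 l,
    HasDerivWithinAt u (-(Q t : ℂ) * u t + ((q t : ℂ) - z) * y t) (Icc 0 l) t

/-- The coefficient matrix of the system at `z = 0`. -/
def sysCoeff (Q q : C(ℝ, ℝ)) : C(ℝ, (ℂ × ℂ) →L[ℂ] ℂ × ℂ) where
  toFun t := (Q t : ℂ) • ((ContinuousLinearMap.fst ℂ ℂ ℂ).prod (-ContinuousLinearMap.snd ℂ ℂ ℂ)) +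
    (q t : ℂ) • ((0 : (ℂ × ℂ) →L[ℂ] ℂ).prod (ContinuousLinearMap.fst ℂ ℂ ℂ)) +
    (ContinuousLinearMap.snd ℂ ℂ ℂ).prod 0
  continuous_toFun := by fun_prop

/-- The coefficient matrix of the spectral parameter in the system. -/
def sysParam : C(ℝ, (ℂ × ℂ) →L[ℂ] ℂ × ℂ) :=
  ContinuousMap.const _ (-((0 : (ℂ × ℂ) →L[ℂ] ℂ).prod (ContinuousLinearMap.fst ℂ ℂ ℂ)))

theorem sysCoeff_apply (Q q : C(ℝ, ℝ)) (z : ℂ) (t : ℝ) (v : ℂ × ℂ) :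
    (sysCoeff Q q + z • sysParam) t v =
      ((Q t : ℂ) * v.1 + v.2, -(Q t : ℂ) * v.2 + ((q t : ℂ) - z) * v.1) := by
  simp [sysCoeff, sysParam]
  ring

variable {l : ℝ} (hl : 0 ≤ l) (Q q : C(ℝ, ℝ))

/-- The solution of the system with initial value `v`. -/
def sysSol (z : ℂ) (v : ℂ × ℂ) (t : ℝ) : ℂ × ℂ := linSol hl (sysCoeff Q q + z • sysParam) v t

theorem sysSol_zero (z : ℂ) (v : ℂ × ℂ) : sysSol hl Q q z v 0 = v := linSol_zero _ _ _

theorem isSys_sysSol (z : ℂ) (v : ℂ × ℂ) :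
    IsSys l Q q z (fun t => (sysSol hl Q q z v t).1) (fun t => (sysSol hl Q q z v t).2) := by
  have h := fun t (ht : t ∈ Icc 0 l) =>
    (hasDerivAt_linSol hl (sysCoeff Q q + z • sysParam) v ht).hasDerivWithinAt (s := Icc 0 l)
  simp only [sysCoeff_apply] at h
  exact ⟨fun t ht => (h t ht).fst, fun t ht => (h t ht).snd⟩

variable {Q q}

theorem IsSys.eq_sysSol {z : ℂ} {y u : ℝ → ℂ} (h : IsSys l Q q z y u) {t : ℝ}
    (ht : t ∈ Icc 0 l) : (y t, u t) = sysSol hl Q q z (y 0, u 0) t := by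
  refine eqOn_linSol hl (sysCoeff Q q + z • sysParam) (y 0, u 0) (Y := fun t => (y t, u t))
    (fun s hs => ?_) rfl ht
  rw [sysCoeff_apply]
  exact (h.deriv_fst s hs).prodMk (h.deriv_snd s hs)

theorem IsSys.comb {z : ℂ} {y u y' u' : ℝ → ℂ} (h : IsSys l Q q z y u)
    (h' : IsSys l Q q z y' u') (a b : ℂ) :
    IsSys l Q q z (fun t => a * y t + b * y' t) (fun t => a * u t + b * u' t) where
  deriv_fst t ht := by
    exact (((h.deriv_fst t ht).const_mul a).add ((h'.deriv_fst t ht).const_mul b)).congr_deriv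
      (by ring)
  deriv_snd t ht := by
    exact (((h.deriv_snd t ht).const_mul a).add ((h'.deriv_snd t ht).const_mul b)).congr_deriv
      (by ring)

theorem IsSys.conj {z : ℂ} {y u : ℝ → ℂ} (h : IsSys l Q q z y u) :
    IsSys l Q q (starRingEnd ℂ z) (fun t => starRingEnd ℂ (y t))
      (fun t => starRingEnd ℂ (u t)) where
  deriv_fst t ht := by
    exact (h.deriv_fst t ht).star.congr_deriv (by simp)
  deriv_snd t ht := by
    exact (h.deriv_snd t ht).star.congr_deriv (by simp)

theorem IsSys.continuousOn {z : ℂ} {y u : ℝ → ℂ} (h : IsSys l Q q z y u) :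
    ContinuousOn y (Icc 0 l) ∧ ContinuousOn u (Icc 0 l) :=
  ⟨fun t ht => (h.deriv_fst t ht).continuousWithinAt,
    fun t ht => (h.deriv_snd t ht).continuousWithinAt⟩

theorem sysSol_comb (z : ℂ) (a b : ℂ) {t : ℝ} (ht : t ∈ Icc 0 l) :
    sysSol hl Q q z (a, b) t =
      (a * (sysSol hl Q q z (1, 0) t).1 + b * (sysSol hl Q q z (0, 1) t).1,
        a * (sysSol hl Q q z (1, 0) t).2 + b * (sysSol hl Q q z (0, 1) t).2) := by
  have h := ((isSys_sysSol hl Q q z (1, 0)).comb (isSys_sysSol hl Q q z (0, 1)) a b).eq_sysSol hl ht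
  rw [h]
  simp [sysSol_zero]

theorem sysSol_conj (z : ℂ) (v : ℂ × ℂ) {t : ℝ} (ht : t ∈ Icc 0 l) :
    sysSol hl Q q (starRingEnd ℂ z) (starRingEnd ℂ v.1, starRingEnd ℂ v.2) t =
      (starRingEnd ℂ (sysSol hl Q q z v t).1, starRingEnd ℂ (sysSol hl Q q z v t).2) := by
  have h := (isSys_sysSol hl Q q z v).conj.eq_sysSol hl ht
  rw [h]
  simp [sysSol_zero]

theorem differentiable_sysSol (v : ℂ × ℂ) {t : ℝ} (ht : t ∈ Icc 0 l) :
    Differentiable ℂ fun z => sysSol hl Q q z v t :=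
  differentiable_linSol hl _ _ v ht

/-- Lagrange's identity. -/
theorem IsSys.lagrange (hl : 0 ≤ l) {z₁ z₂ : ℂ} {y₁ u₁ y₂ u₂ : ℝ → ℂ}
    (h₁ : IsSys l Q q z₁ y₁ u₁) (h₂ : IsSys l Q q z₂ y₂ u₂) :
    (y₁ l * u₂ l - u₁ l * y₂ l) - (y₁ 0 * u₂ 0 - u₁ 0 * y₂ 0) =
      (z₁ - z₂) * ∫ t in (0 : ℝ)..l, y₁ t * y₂ t := by
  have hd : ∀ t ∈ Icc 0 l, HasDerivWithinAt (fun t => y₁ t * u₂ t - u₁ t * y₂ t)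
      ((z₁ - z₂) * (y₁ t * y₂ t)) (Icc 0 l) t := fun t ht => by
    exact (((h₁.deriv_fst t ht).mul (h₂.deriv_snd t ht)).sub
      ((h₁.deriv_snd t ht).mul (h₂.deriv_fst t ht))).congr_deriv (by ring)
  have hc : ContinuousOn (fun t => (z₁ - z₂) * (y₁ t * y₂ t)) (Icc 0 l) :=
    continuousOn_const.mul (h₁.continuousOn.1.mul h₂.continuousOn.1)
  rw [← intervalIntegral.integral_const_mul]
  symm
  refine intervalIntegral.integral_eq_sub_of_hasDerivAt_of_le hl
    (f := fun t => y₁ t * u₂ t - u₁ t * y₂ t)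
    (fun s hs => (hd s hs).continuousWithinAt)
    (fun s hs => (hd s ⟨hs.1.le, hs.2.le⟩).hasDerivAt (Icc_mem_nhds hs.1 hs.2)) ?_
  apply ContinuousOn.intervalIntegrable
  rwa [uIcc_of_le hl]

/-- Lagrange's identity with equal spectral parameters. -/
theorem wronskian_sysSol (z : ℂ) :
    (sysSol hl Q q z (1, 0) l).1 * (sysSol hl Q q z (0, 1) l).2 -
      (sysSol hl Q q z (1, 0) l).2 * (sysSol hl Q q z (0, 1) l).1 = 1 := by
  have h := (isSys_sysSol hl Q q z (1, 0)).lagrange hl (isSys_sysSol hl Q q z (0, 1))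
  simp only [sysSol_zero, sub_self, zero_mul, mul_one, mul_zero, sub_zero] at h
  exact sub_eq_zero.1 h

end System

/-! ### Equivalence of the `L²` equation with the continuous system. -/

section Regularization

/-- `Q` is a primitive of `V - w` on `[0,l]`, for an integrable `V`. -/
structure IsReg (l : ℝ) (V : ℝ → ℝ) (Q w : C(ℝ, ℝ)) : Prop where
  integrable : IntervalIntegrable V volume 0 l
  prim : ∀ t ∈ Icc 0 l, Q t = ∫ s in (0 : ℝ)..t, (V s - w s)

variable {l : ℝ} {V : ℝ → ℝ} {Q w : C(ℝ, ℝ)}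

theorem IsReg.mono (h : IsReg l V Q w) {b : ℝ} (hb : b ∈ Icc 0 l) : IsReg b V Q w where
  integrable := h.integrable.mono_set (by
    rw [uIcc_of_le hb.1, uIcc_of_le (hb.1.trans hb.2)]; exact Icc_subset_Icc_right hb.2)
  prim t ht := h.prim t ⟨ht.1, ht.2.trans hb.2⟩

theorem IsReg.zero (hl : 0 ≤ l) (h : IsReg l V Q w) : Q 0 = 0 := by
  simpa using h.prim 0 ⟨le_rfl, hl⟩

theorem IsReg.mul_eq (h : IsReg l V Q w) {b : ℝ} (hb : b ∈ Icc 0 l) {y r : ℝ → ℂ}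
    (hy : ∀ t ∈ Icc 0 l, HasDerivWithinAt y (r t) (Icc 0 l) t) (hr : ContinuousOn r (Icc 0 l)) :
    (Q b : ℂ) * y b = ∫ s in (0 : ℝ)..b, (((V s - w s : ℝ) : ℂ) * y s + (Q s : ℂ) * r s) := by
  have hsub : Icc 0 b ⊆ Icc 0 l := Icc_subset_Icc_right hb.2
  exact primitive_mul_eq_integral (d := fun s => V s - w s) hb.1
    ((h.mono hb).integrable.sub (w.continuous.intervalIntegrable _ _))
    (fun t ht => h.prim t (hsub ht)) (fun t ht => (hy t (hsub ht)).mono hsub) (hr.mono hsub)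

theorem hasDerivWithinAt_primitive {l : ℝ} (hl : 0 ≤ l) {f : ℝ → ℂ} (hf : ContinuousOn f (Icc 0 l))
    {t : ℝ} (ht : t ∈ Icc 0 l) :
    HasDerivWithinAt (fun t => ∫ s in (0 : ℝ)..t, f s) (f t) (Icc 0 l) t := by
  have hc : Continuous (IccExtend hl ((Icc 0 l).domRestrict f)) :=
    (continuousOn_iff_continuous_domRestrict.1 hf).Icc_extend'
  have h1 := (hc.integral_hasStrictDerivAt 0 t).hasDerivAt.hasDerivWithinAt (s := Icc 0 l)
  rw [IccExtend_of_mem _ _ ht] at h1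
  have he : ∀ s ∈ Icc 0 l, ∫ r in (0 : ℝ)..s, f r =
      ∫ r in (0 : ℝ)..s, IccExtend hl ((Icc 0 l).domRestrict f) r := fun s hs => by
    refine intervalIntegral.integral_congr fun r hr => ?_
    rw [uIcc_of_le hs.1] at hr
    rw [IccExtend_of_mem _ _ (⟨hr.1, hr.2.trans hs.2⟩ : r ∈ Icc 0 l)]
    rfl
  exact h1.congr he (he t ht)

/-- For `u = p - Q y` the potential cancels: `u' = (V - z) y - (V - w) y - Q p = (w - z) y - Q (u +
Q y)`. This is where the coefficient `w - Q²` comes from. -/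
theorem IsSolution.isSys (hl : 0 ≤ l) (hR : IsReg l V Q w) {z : ℂ} {y p : ℝ → ℂ}
    (h : IsSolution 0 l V z y p) :
    IsSys l Q (w - Q * Q) z y (fun t => p t - (Q t : ℂ) * y t) := by
  obtain ⟨g, hg, hae⟩ := h
  have hyc : ContinuousOn y (Icc 0 l) := fun t ht => (hg.hasDeriv t ht).continuousWithinAt
  have hgi : IntervalIntegrable g volume 0 l := hg.intervalIntegrable ⟨hl, le_rfl⟩
  have hpc : ContinuousOn p (Icc 0 l) := by
    have := (absolutelyContinuousOnInterval_integral hgi).continuousOn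
    rw [uIcc_of_le hl] at this
    exact (continuousOn_const.add this).congr hg.deriv_eq
  have hQc : ContinuousOn (fun t => (Q t : ℂ)) (Icc 0 l) := by fun_prop
  have hwc : ContinuousOn (fun t => (w t : ℂ)) (Icc 0 l) := by fun_prop
  refine ⟨fun t ht => by simpa using hg.hasDeriv t ht, fun t ht => ?_⟩
  -- The integrand is now continuous, so the quasi-derivative is differentiable everywhere and not
  -- just almost everywhere.
  have key : ∀ s ∈ Icc 0 l, p s - (Q s : ℂ) * y s =
      p 0 + ∫ r in (0 : ℝ)..s, (((w r : ℂ) - z) * y r - (Q r : ℂ) * p r) := fun s hs => by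
    have hsub : Icc 0 s ⊆ Icc 0 l := Icc_subset_Icc_right hs.2
    rw [hR.mul_eq hs hg.hasDeriv hpc, hg.deriv_eq s hs, add_sub_assoc,
      ← intervalIntegral.integral_sub (hg.intervalIntegrable hs)]
    · congr 1
      refine intervalIntegral.integral_congr_ae ?_
      rw [ae_restrict_iff' measurableSet_Icc] at hae
      filter_upwards [hae] with r hr hr'
      rw [uIoc_of_le hs.1] at hr'
      have := hr ⟨hr'.1.le, hr'.2.trans hs.2⟩
      push_cast
      linear_combination -this
    · refine IntervalIntegrable.add ?_ ?_
      · refine IntervalIntegrable.mul_continuousOn ?_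
          (by rw [uIcc_of_le hs.1]; exact hyc.mono hsub)
        exact intervalIntegrable_ofReal
          ((hR.mono hs).integrable.sub (w.continuous.intervalIntegrable _ _))
      · apply ContinuousOn.intervalIntegrable
        rw [uIcc_of_le hs.1]
        exact (hQc.mul hpc).mono hsub
  have hd := (hasDerivWithinAt_primitive hl
    (f := fun r => ((w r : ℂ) - z) * y r - (Q r : ℂ) * p r) (((hwc.sub continuousOn_const).mul hyc).sub
    (hQc.mul hpc)) ht).const_add (p 0)
  refine (hd.congr key (key t ht)).congr_deriv ?_
  simp
  ring

/-- The inverse substitution `p = u + Q y`. The second derivative is `(V - z) y`, which is in `L²`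
because `V` is and `y` is bounded. -/
theorem IsSys.isSolution (hl : 0 ≤ l) (hV : MemLp V 2 (volume.restrict (Icc 0 l)))
    (hR : IsReg l V Q w) {z : ℂ} {y u : ℝ → ℂ} (h : IsSys l Q (w - Q * Q) z y u) :
    IsSolution 0 l V z y (fun t => u t + (Q t : ℂ) * y t) := by
  obtain ⟨hyc, huc⟩ := h.continuousOn
  have hQc : ContinuousOn (fun t => (Q t : ℂ)) (Icc 0 l) := by fun_prop
  have hqc : ContinuousOn (fun t => ((w - Q * Q) t : ℂ)) (Icc 0 l) := by fun_prop
  have hVC : MemLp (fun t => (V t : ℂ) - z) 2 (volume.restrict (Icc 0 l)) :=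
    hV.ofReal.sub (memLp_const z)
  refine ⟨fun t => ((V t : ℂ) - z) * y t, ⟨?_, fun t ht => ?_, fun t ht => ?_⟩,
    ae_of_all _ fun t => by ring⟩
  · obtain ⟨C, hC⟩ := isCompact_Icc.exists_bound_of_continuousOn hyc
    refine hVC.of_le_mul (c := C) (hVC.aestronglyMeasurable.mul
      (hyc.aestronglyMeasurable measurableSet_Icc)) ?_
    refine (ae_restrict_iff' measurableSet_Icc).2 (ae_of_all _ fun t ht => ?_)
    rw [norm_mul, mul_comm]
    exact mul_le_mul_of_nonneg_right (hC t ht) (norm_nonneg _)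
  · exact (h.deriv_fst t ht).congr_deriv (add_comm _ _)
  · have hsub : Icc 0 t ⊆ Icc 0 l := Icc_subset_Icc_right ht.2
    have hy'c : ContinuousOn (fun t => (Q t : ℂ) * y t + u t) (Icc 0 l) := (hQc.mul hyc).add huc
    have hu'c : ContinuousOn (fun t => -(Q t : ℂ) * u t + (((w - Q * Q) t : ℂ) - z) * y t)
      (Icc 0 l) := (hQc.neg.mul huc).add ((hqc.sub continuousOn_const).mul hyc)
    have hudiff := intervalIntegral.integral_eq_sub_of_hasDerivAt_of_le ht.1 (huc.mono hsub)
      (fun s hs => (h.deriv_snd s ⟨hs.1.le, hs.2.le.trans ht.2⟩).hasDerivAt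
        (Icc_mem_nhds hs.1 (hs.2.trans_le ht.2)))
      (by apply ContinuousOn.intervalIntegrable; rw [uIcc_of_le ht.1]; exact hu'c.mono hsub)
    have hprod := hR.mul_eq ht h.deriv_fst hy'c
    rw [hprod, hR.zero hl, ← sub_add_cancel (u t) (u 0), ← hudiff]
    simp only [Complex.ofReal_zero, zero_mul, add_zero]
    rw [add_comm _ (u 0), add_assoc, ← intervalIntegral.integral_add]
    · congr 1
      refine intervalIntegral.integral_congr fun s _ => ?_
      simp
      ring
    · apply ContinuousOn.intervalIntegrable; rw [uIcc_of_le ht.1]; exact hu'c.mono hsub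
    · refine IntervalIntegrable.add ?_ ?_
      · refine IntervalIntegrable.mul_continuousOn ?_
          (by rw [uIcc_of_le ht.1]; exact hyc.mono hsub)
        exact intervalIntegrable_ofReal
          ((hR.mono ht).integrable.sub (w.continuous.intervalIntegrable _ _))
      · apply ContinuousOn.intervalIntegrable
        rw [uIcc_of_le ht.1]
        exact (hQc.mul hy'c).mono hsub

/-- Take `w` continuous within `ε` of `V` in `L¹`; then `|Q| ≤ ‖V - w‖₁ ≤ ε`. The smallness of `Q`
is what the high-frequency estimate relies on. -/
theorem exists_isReg (hl : 0 ≤ l) (hV : MemLp V 2 (volume.restrict (Icc 0 l))) {ε : ℝ}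
    (hε : 0 < ε) : ∃ Q w : C(ℝ, ℝ), IsReg l V Q w ∧ ∀ t, |Q t| ≤ ε := by
  have hVi : IntegrableOn V (Icc 0 l) volume := hV.integrable (by norm_num)
  have hVi' : IntervalIntegrable V volume 0 l := by
    rwa [intervalIntegrable_iff_integrableOn_Icc_of_le hl]
  obtain ⟨w, hw, hwi⟩ := hVi.exists_boundedContinuous_integral_sub_le hε
  have hd : IntervalIntegrable (fun s => V s - w s) volume 0 l :=
    hVi'.sub (w.continuous.intervalIntegrable _ _)
  have hc : ContinuousOn (fun t => ∫ s in (0 : ℝ)..t, (V s - w s)) (Icc 0 l) := by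
    have := (hd.absolutelyContinuousOnInterval_intervalIntegral (c := 0) (by simp)).continuousOn
    rwa [uIcc_of_le hl] at this
  refine ⟨⟨IccExtend hl ((Icc 0 l).domRestrict fun t => ∫ s in (0 : ℝ)..t, (V s - w s)),
    (continuousOn_iff_continuous_domRestrict.1 hc).Icc_extend'⟩, w.toContinuousMap,
    ⟨hVi', fun t ht => ?_⟩, fun t => ?_⟩
  · exact IccExtend_of_mem hl
      ((Icc 0 l).domRestrict fun t => ∫ s in (0 : ℝ)..t, (V s - w s)) ht
  · simp only [ContinuousMap.coe_mk, IccExtend, Function.comp_apply]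
    have ht := (projIcc 0 l hl t).2
    set s : ℝ := (projIcc 0 l hl t : ℝ)
    rw [← Real.norm_eq_abs]
    refine (intervalIntegral.norm_integral_le_integral_norm ht.1).trans (le_trans ?_ hw)
    rw [intervalIntegral.integral_of_le ht.1]
    refine setIntegral_mono_set ?_ (ae_of_all _ fun _ => norm_nonneg _) ?_
    · exact (hVi.sub hwi).norm
    · exact (Ioc_subset_Icc_self.trans (Icc_subset_Icc_right ht.2)).eventuallyLE

end Regularization

/-! ### Enumeration of simple real zeros and alternation of signs. -/

section Enumeration

theorem exists_pos_right_of_hasDerivAt_pos {f : ℝ → ℝ} {a b d : ℝ} (hab : a < b) (ha : f a = 0)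
    (hf : HasDerivAt f d a) (hd : 0 < d) : ∃ x ∈ Ioo a b, 0 < f x := by
  have h := eventually_nhdsWithin_sign_eq_of_deriv_pos (by rwa [hf.deriv]) ha
  obtain ⟨x, hx, hx'⟩ := ((h.filter_mono nhdsWithin_le_nhds).and (Ioo_mem_nhdsGT hab)).exists
  refine ⟨x, hx', ?_⟩
  rwa [sign_pos (sub_pos.2 hx'.1), sign_eq_one_iff] at hx

theorem exists_neg_left_of_hasDerivAt_pos {f : ℝ → ℝ} {a b d : ℝ} (hab : a < b) (hb : f b = 0)
    (hf : HasDerivAt f d b) (hd : 0 < d) : ∃ x ∈ Ioo a b, f x < 0 := by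
  have h := eventually_nhdsWithin_sign_eq_of_deriv_pos (by rwa [hf.deriv]) hb
  obtain ⟨x, hx, hx'⟩ := ((h.filter_mono nhdsWithin_le_nhds).and (Ioo_mem_nhdsLT hab)).exists
  refine ⟨x, hx', ?_⟩
  rwa [sign_neg (sub_neg.2 hx'.2), sign_eq_neg_one_iff] at hx

/-- At consecutive simple zeros the derivatives have opposite signs. -/
theorem deriv_neg_of_deriv_pos_of_no_zero {f : ℝ → ℝ} {a b d e : ℝ} (hab : a < b)
    (hc : Continuous f) (ha : f a = 0) (hb : f b = 0) (hfa : HasDerivAt f d a)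
    (hfb : HasDerivAt f e b) (hd : 0 < d) (he : e ≠ 0) (hne : ∀ x ∈ Ioo a b, f x ≠ 0) :
    e < 0 := by
  by_contra hcon
  have he' : 0 < e := lt_of_le_of_ne (not_lt.1 hcon) he.symm
  obtain ⟨x, hx, hx0⟩ := exists_pos_right_of_hasDerivAt_pos hab ha hfa hd
  obtain ⟨y, hy, hy0⟩ := exists_neg_left_of_hasDerivAt_pos hab hb hfb he'
  have hsub : uIcc x y ⊆ Ioo a b := by
    intro t ht
    rw [mem_uIcc] at ht
    rcases ht with ht | ht
    · exact ⟨hx.1.trans_le ht.1, ht.2.trans_lt hy.2⟩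
    · exact ⟨hy.1.trans_le ht.1, ht.2.trans_lt hx.2⟩
  obtain ⟨t, ht, ht0⟩ := intermediate_value_uIcc (hc.continuousOn (s := uIcc x y))
    (mem_uIcc.2 (Or.inr ⟨hy0.le, hx0.le⟩) : (0 : ℝ) ∈ uIcc (f x) (f y))
  exact hne t (hsub ht) ht0

/-- An accumulation point of zeros would itself be a zero, but simple zeros are isolated. -/
theorem finite_zeros_Icc {f f' : ℝ → ℝ} (hf : ∀ x, HasDerivAt f (f' x) x)
    (hz : ∀ x, f x = 0 → f' x ≠ 0) (a b : ℝ) : ({x | f x = 0} ∩ Icc a b).Finite := by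
  by_contra hinf
  obtain ⟨c, -, hc⟩ := Set.Infinite.exists_accPt_of_subset_isCompact hinf isCompact_Icc
    inter_subset_right
  have hcont : Continuous f := continuous_iff_continuousAt.2 fun x => (hf x).continuousAt
  have hcl : IsClosed {x | f x = 0} := isClosed_eq hcont continuous_const
  have hc' : AccPt c (𝓟 {x | f x = 0}) := hc.mono (principal_mono.2 inter_subset_left)
  have hc0 : c ∈ {x | f x = 0} :=
    hcl.closure_eq.subset (mem_closure_iff_clusterPt.2 hc'.clusterPt)
  have hev := (hf c).eventually_ne (c := 0) (hz c hc0)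
  rw [accPt_iff_frequently_nhdsNE] at hc'
  exact hc' (hev.mono fun x hx h => hx h)

/-- The zeros of a function with simple zeros, bounded below and unbounded above, form a sequence,
and the derivative at the zeros alternates in sign. -/
theorem exists_strictMono_zeros {f f' g : ℝ → ℝ} (hf : ∀ x, HasDerivAt f (f' x) x)
    (hz : ∀ x, f x = 0 → 0 < g x * f' x) {x₀ : ℝ} (hneg : ∀ x < x₀, 0 < f x)
    (hub : ∀ x, ∃ t, x < t ∧ f t = 0) :
    ∃ μ : ℕ → ℝ, StrictMono μ ∧ (∀ x, f x = 0 ↔ ∃ k, x = μ k) ∧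
      (∀ k, Even k → g (μ k) < 0) ∧ ∀ k, Odd k → 0 < g (μ k) := by
  have hz' : ∀ x, f x = 0 → f' x ≠ 0 := fun x hx h => by simpa [h] using hz x hx
  have hcont : Continuous f := continuous_iff_continuousAt.2 fun x => (hf x).continuousAt
  have hnext : ∀ a, ∃ b, a < b ∧ f b = 0 ∧ ∀ x ∈ Ioo a b, f x ≠ 0 := by
    intro a
    obtain ⟨c, hac, hc⟩ := hub a
    have hfin : ({x | f x = 0} ∩ Ioc a c).Finite :=
      (finite_zeros_Icc hf hz' a c).subset (inter_subset_inter_right _ Ioc_subset_Icc_self)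
    obtain ⟨b, hb, hmin⟩ := hfin.exists_minimal ⟨c, hc, hac, le_rfl⟩
    refine ⟨b, hb.2.1, hb.1, fun x hx hx0 => ?_⟩
    exact (hmin ⟨hx0, hx.1, hx.2.le.trans hb.2.2⟩ hx.2.le).not_gt hx.2
  choose nx hnx hnx0 hnxne using hnext
  -- There are no zeros below `x₀`, so the first zero after `x₀ - 1` is the smallest of all.
  let μ : ℕ → ℝ := fun k => Nat.rec (nx (x₀ - 1)) (fun _ a => nx a) k
  have hμs : ∀ k, μ (k + 1) = nx (μ k) := fun k => rfl
  have hμ0 : μ 0 = nx (x₀ - 1) := rfl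
  have hmono : StrictMono μ := strictMono_nat_of_lt_succ fun k => by rw [hμs]; exact hnx _
  have hzero : ∀ k, f (μ k) = 0 := fun k => by
    cases k with
    | zero => exact hnx0 _
    | succ k => exact hnx0 _
  have hfirst : ∀ x < μ 0, f x ≠ 0 := by
    intro x hx
    rcases lt_or_ge x x₀ with h | h
    · exact (hneg x h).ne'
    · exact hnxne _ x ⟨by linarith, hx⟩
  have hsurj : ∀ x, f x = 0 → ∃ k, x = μ k := by
    intro x hx
    by_contra! hcon
    have hlt : ∀ k, μ k < x := by
      intro k
      induction k with
      | zero => exact lt_of_le_of_ne (not_lt.1 fun h => hfirst x h hx) (hcon 0).symm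
      | succ k ih =>
        refine lt_of_le_of_ne (not_lt.1 fun h => ?_) (hcon (k + 1)).symm
        exact hnxne (μ k) x ⟨ih, h⟩ hx
    refine Set.infinite_of_injective_forall_mem hmono.injective
      (fun k => (⟨hzero k, hmono.monotone (Nat.zero_le k), (hlt k).le⟩ :
        μ k ∈ {x | f x = 0} ∩ Icc (μ 0) x)) (finite_zeros_Icc hf hz' (μ 0) x)
  have hsign : ∀ k, (Even k → f' (μ k) < 0) ∧ (Odd k → 0 < f' (μ k)) := by
    intro k
    induction k with
    | zero =>
      refine ⟨fun _ => ?_, fun h => by simp at h⟩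
      -- A positive derivative at the smallest zero would make `f` negative just to its left, while
      -- `f > 0` further left: a still smaller zero.
      by_contra hcon
      have hpos : 0 < f' (μ 0) := lt_of_le_of_ne (not_lt.1 hcon) (hz' _ (hzero 0)).symm
      have hx0 : min x₀ (μ 0) - 1 < μ 0 := by linarith [min_le_right x₀ (μ 0)]
      obtain ⟨y, hy, hy0⟩ := exists_neg_left_of_hasDerivAt_pos hx0 (hzero 0) (hf _) hpos
      have hp := hneg (min x₀ (μ 0) - 1) (by linarith [min_le_left x₀ (μ 0)])
      obtain ⟨t, ht, ht0⟩ := intermediate_value_Icc' hy.1.le hcont.continuousOn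
        (⟨hy0.le, hp.le⟩ : (0 : ℝ) ∈ Icc (f y) (f (min x₀ (μ 0) - 1)))
      exact hfirst t (ht.2.trans_lt hy.2) ht0
    | succ k ih =>
      have hlt : μ k < μ (k + 1) := hmono (Nat.lt_succ_self k)
      have hne : ∀ x ∈ Ioo (μ k) (μ (k + 1)), f x ≠ 0 := fun x hx => hnxne (μ k) x hx
      refine ⟨fun h => ?_, fun h => ?_⟩
      · have hk : Odd k := by simpa [Nat.even_add_one] using h
        exact deriv_neg_of_deriv_pos_of_no_zero hlt hcont (hzero k) (hzero (k + 1)) (hf _) (hf _)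
          (ih.2 hk) (hz' _ (hzero (k + 1))) hne
      · have hk : Even k := by simpa [Nat.odd_add_one] using h
        have := deriv_neg_of_deriv_pos_of_no_zero (f := fun x => - f x) hlt hcont.neg
          (by simp [hzero]) (by simp [hzero]) (hf _).neg (hf _).neg
          (neg_pos.2 (ih.1 hk)) (neg_ne_zero.2 (hz' _ (hzero (k + 1))))
          (fun x hx => neg_ne_zero.2 (hne x hx))
        exact neg_lt_zero.1 this
  refine ⟨μ, hmono, fun x => ⟨hsurj x, ?_⟩, fun k hk => ?_, fun k hk => ?_⟩
  · rintro ⟨k, rfl⟩; exact hzero k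
  · have h1 := hz _ (hzero k)
    have h2 := (hsign k).1 hk
    exact neg_of_mul_pos_left h1 h2.le
  · have h1 := hz _ (hzero k)
    have h2 := (hsign k).2 hk
    exact pos_of_mul_pos_left h1 h2.le

end Enumeration

/-! ### Real solutions at very negative and at large positive spectral parameter. -/

section RealSystem

variable {l : ℝ} {Q q : C(ℝ, ℝ)}

/-- The system for real-valued functions and a real spectral parameter. -/
structure IsRealSys (l : ℝ) (Q q : C(ℝ, ℝ)) (x : ℝ) (Y U : ℝ → ℝ) : Prop where
  deriv_fst : ∀ t ∈ Icc 0 l, HasDerivWithinAt Y (Q t * Y t + U t) (Icc 0 l) t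
  deriv_snd : ∀ t ∈ Icc 0 l, HasDerivWithinAt U (-Q t * U t + (q t - x) * Y t) (Icc 0 l) t

theorem IsSys.re {x : ℝ} {y u : ℝ → ℂ} (h : IsSys l Q q x y u) :
    IsRealSys l Q q x (fun t => (y t).re) (fun t => (u t).re) where
  deriv_fst t ht := ((Complex.reCLM.hasFDerivAt.comp_hasDerivWithinAt t
    (h.deriv_fst t ht))).congr_deriv (by simp)
  deriv_snd t ht := ((Complex.reCLM.hasFDerivAt.comp_hasDerivWithinAt t
    (h.deriv_snd t ht))).congr_deriv (by simp)

/-- Here `(Y U)' = U² + (q - x) Y² ≥ 0`. As `Y U` is positive just to the right of 0, it remains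
positive and `Y` cannot return to zero. -/
theorem IsRealSys.pos_of_le (hl : 0 < l) {x : ℝ} {Y U : ℝ → ℝ} (h : IsRealSys l Q q x Y U)
    (hY0 : Y 0 = 0) (hU0 : U 0 = 1) (hx : ∀ t ∈ Icc 0 l, x ≤ q t) : 0 < Y l := by
  have hYc : ContinuousOn Y (Icc 0 l) := fun t ht => (h.deriv_fst t ht).continuousWithinAt
  have hUc : ContinuousOn U (Icc 0 l) := fun t ht => (h.deriv_snd t ht).continuousWithinAt
  have hmono : MonotoneOn (fun t => Y t * U t) (Icc 0 l) := by
    refine monotoneOn_of_hasDerivWithinAt_nonneg (convex_Icc 0 l) (hYc.mul hUc)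
      (f' := fun t => U t ^ 2 + (q t - x) * Y t ^ 2) (fun t ht => ?_) (fun t ht => ?_)
    · refine (((h.deriv_fst t (interior_subset ht)).mul
        (h.deriv_snd t (interior_subset ht))).mono interior_subset).congr_deriv ?_
      ring
    · have := sub_nonneg.2 (hx t (interior_subset ht))
      positivity
  have h0 : (0 : ℝ) ∈ Icc 0 l := ⟨le_rfl, hl.le⟩
  have hd0 : HasDerivWithinAt Y 1 (Ioi 0) 0 :=
    ((h.deriv_fst 0 h0).congr_deriv (by simp [hY0, hU0])).mono_of_mem_nhdsWithin
      (mem_of_superset (Ioo_mem_nhdsGT hl) Ioo_subset_Icc_self)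
  have hYpos : ∀ᶠ t in 𝓝[>] (0 : ℝ), 0 < Y t := by
    have h1 := (hasDerivWithinAt_iff_tendsto_slope' (by simp)).1 hd0
    filter_upwards [h1.eventually (lt_mem_nhds zero_lt_one), self_mem_nhdsWithin] with t ht ht0
    rw [slope_def_field, hY0, sub_zero, sub_zero] at ht
    exact (div_pos_iff_of_pos_right ht0).1 ht
  have hUpos : ∀ᶠ t in 𝓝[>] (0 : ℝ), 0 < U t := by
    have h1 : Tendsto U (𝓝[>] 0) (𝓝 (U 0)) :=
      ((h.deriv_snd 0 h0).continuousWithinAt.tendsto).mono_left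
      (nhdsWithin_le_of_mem (mem_of_superset (Ioo_mem_nhdsGT hl) Ioo_subset_Icc_self))
    rw [hU0] at h1
    exact h1.eventually (lt_mem_nhds zero_lt_one)
  obtain ⟨δ, ⟨hδY, hδU⟩, hδ⟩ := ((hYpos.and hUpos).and (Ioo_mem_nhdsGT hl)).exists
  by_contra hcon
  obtain ⟨t, ht, ht0⟩ := intermediate_value_Icc' hδ.2.le
    (hYc.mono (Icc_subset_Icc_left hδ.1.le)) (⟨not_lt.1 hcon, hδY.le⟩ : (0 : ℝ) ∈ Icc (Y l) (Y δ))
  have := hmono ⟨hδ.1.le, hδ.2.le⟩ ⟨hδ.1.le.trans ht.1, ht.2⟩ ht.1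
  simp only [ht0, zero_mul] at this
  exact (mul_pos hδY hδU).not_ge this

/-- Large-frequency behaviour of the solution with `Y(0) = 0`, `U(0) = 1`. -/
theorem IsRealSys.abs_sub_sin_le (hl : 0 < l) {k ε M : ℝ} {Y U : ℝ → ℝ}
    (h : IsRealSys l Q q (k ^ 2) Y U) (hY0 : Y 0 = 0) (hU0 : U 0 = 1) (hk : 0 < k)
    (hε : 0 < ε) (hεl : ε * l ≤ 1 / 10) (hQ : ∀ t ∈ Icc 0 l, |Q t| ≤ ε)
    (hq : ∀ t ∈ Icc 0 l, |q t| ≤ M) (hkM : M ≤ ε * k) :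
    |k * Y l - Real.sin (k * l)| ≤ 6 / 10 := by
  have hqk : ∀ t ∈ Icc 0 l, |q t| ≤ ε * k := fun t ht => (hq t ht).trans hkM
  have hE : ∀ t ∈ Icc 0 l, HasDerivWithinAt (fun t => (k * Y t) ^ 2 + U t ^ 2)
      (2 * Q t * (k * Y t) ^ 2 - 2 * Q t * U t ^ 2 + 2 * q t * U t * Y t) (Icc 0 l) t := by
    intro t ht
    refine ((((h.deriv_fst t ht).const_mul k).pow 2).add ((h.deriv_snd t ht).pow 2)).congr_deriv ?_
    simp
    ring
  -- In the derivative of this energy the terms `2k²YU` cancel and the rest is at most `3ε` times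
  -- the energy, so Gronwall bounds it by `exp (3εl) ≤ e < 4`.
  have hEb : ∀ t ∈ Icc 0 l, (k * Y t) ^ 2 + U t ^ 2 ≤ 4 := by
    intro t ht
    have hgr := norm_le_gronwallBound_of_norm_deriv_right_le (δ := 1) (K := 3 * ε) (ε := 0)
      (f := fun t => (k * Y t) ^ 2 + U t ^ 2)
      (f' := fun t => 2 * Q t * (k * Y t) ^ 2 - 2 * Q t * U t ^ 2 + 2 * q t * U t * Y t)
      (a := 0) (b := l)
      (fun s hs => (hE s hs).continuousWithinAt)
      (fun s hs => (hE s ⟨hs.1, hs.2.le⟩).mono_of_mem_nhdsWithin (Icc_mem_nhdsGE_of_mem hs))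
      (by simp [hY0, hU0]) (fun s hs => ?_) t ht
    · rw [gronwallBound_ε0, one_mul, sub_zero, Real.norm_eq_abs,
        abs_of_nonneg (by positivity)] at hgr
      refine hgr.trans ?_
      have h1 : 3 * ε * t ≤ 1 := by
        have := mul_le_mul_of_nonneg_left ht.2 hε.le
        linarith
      exact (Real.exp_le_exp.2 h1).trans (by linarith [Real.exp_one_lt_d9])
    · have hs' : s ∈ Icc 0 l := ⟨hs.1, hs.2.le⟩
      simp only [Real.norm_eq_abs, add_zero]
      rw [abs_of_nonneg (by positivity : 0 ≤ (k * Y s) ^ 2 + U s ^ 2)]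
      have e1 : |2 * Q s * (k * Y s) ^ 2| ≤ 2 * ε * (k * Y s) ^ 2 := by
        rw [abs_mul, abs_mul, abs_two, abs_of_nonneg (sq_nonneg (k * Y s))]
        have := hQ s hs'
        gcongr
      have e2 : |2 * Q s * U s ^ 2| ≤ 2 * ε * U s ^ 2 := by
        rw [abs_mul, abs_mul, abs_two, abs_of_nonneg (sq_nonneg (U s))]
        have := hQ s hs'
        gcongr
      have e3 : |2 * q s * U s * Y s| ≤ ε * ((k * Y s) ^ 2 + U s ^ 2) := by
        have : |2 * q s * U s * Y s| ≤ 2 * (ε * k) * |U s| * |Y s| := by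
          rw [abs_mul, abs_mul, abs_mul, abs_two]
          have := hqk s hs'
          gcongr
        refine this.trans ?_
        have h2 : 2 * |U s| * (k * |Y s|) ≤ (k * Y s) ^ 2 + U s ^ 2 := by
          have := two_mul_le_add_sq (|U s|) (k * |Y s|)
          rw [mul_pow, sq_abs, sq_abs] at this
          rw [mul_pow]
          linarith
        calc 2 * (ε * k) * |U s| * |Y s| = ε * (2 * |U s| * (k * |Y s|)) := by ring
          _ ≤ _ := mul_le_mul_of_nonneg_left h2 hε.le
      calc _ ≤ |2 * Q s * (k * Y s) ^ 2 - 2 * Q s * U s ^ 2| + |2 * q s * U s * Y s| :=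
            abs_add_le _ _
        _ ≤ (|2 * Q s * (k * Y s) ^ 2| + |2 * Q s * U s ^ 2|) + |2 * q s * U s * Y s| := by
          gcongr; exact abs_sub _ _
        _ ≤ _ := by linarith
  -- Variation of constants: this function is `sin (k l)` at `t = 0` and `k Y(l)` at `t = l`, and
  -- would be constant if `Q = q = 0`. Its derivative is at most `6ε`, so it changes by at most `6εl
  -- ≤ 6/10`.
  have hm : ∀ t ∈ Icc 0 l, HasDerivWithinAt
      (fun t => U t * Real.sin (k * (l - t)) + k * Y t * Real.cos (k * (l - t)))
      (-(Q t) * U t * Real.sin (k * (l - t)) + q t * Y t * Real.sin (k * (l - t)) +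
        Q t * (k * Y t) * Real.cos (k * (l - t))) (Icc 0 l) t := by
    intro t ht
    have ha : HasDerivWithinAt (fun t => k * (l - t)) (k * (-1)) (Icc 0 l) t :=
      (((hasDerivAt_id t).const_sub l).const_mul k).hasDerivWithinAt
    refine (((h.deriv_snd t ht).mul ha.sin).add
      (((h.deriv_fst t ht).const_mul k).mul ha.cos)).congr_deriv ?_
    ring
  have hmb : ∀ t ∈ Icc 0 l, ‖-(Q t) * U t * Real.sin (k * (l - t)) +
      q t * Y t * Real.sin (k * (l - t)) + Q t * (k * Y t) * Real.cos (k * (l - t))‖ ≤ 6 * ε := by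
    intro t ht
    have hb := hEb t ht
    have hU : |U t| ≤ 2 := abs_le_of_sq_le_sq (by nlinarith [sq_nonneg (k * Y t)]) (by norm_num)
    have hY : |k * Y t| ≤ 2 := abs_le_of_sq_le_sq (by nlinarith [sq_nonneg (U t)]) (by norm_num)
    have hY' : k * |Y t| ≤ 2 := by rwa [abs_mul, abs_of_pos hk] at hY
    have hs := Real.abs_sin_le_one (k * (l - t))
    have hc := Real.abs_cos_le_one (k * (l - t))
    have f1 : |-(Q t) * U t * Real.sin (k * (l - t))| ≤ ε * 2 * 1 := by
      rw [abs_mul, abs_mul, abs_neg]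
      have := hQ t ht
      gcongr
    have f2 : |q t * Y t * Real.sin (k * (l - t))| ≤ ε * 2 := by
      rw [abs_mul, abs_mul]
      calc |q t| * |Y t| * |Real.sin (k * (l - t))| ≤ (ε * k) * |Y t| * 1 := by
            have := hqk t ht
            gcongr
        _ = ε * (k * |Y t|) := by ring
        _ ≤ ε * 2 := by gcongr
    have f3 : |Q t * (k * Y t) * Real.cos (k * (l - t))| ≤ ε * 2 * 1 := by
      rw [abs_mul, abs_mul]
      have := hQ t ht
      gcongr
    rw [Real.norm_eq_abs]
    refine (abs_add_three _ _ _).trans ?_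
    linarith
  have hmv := (convex_Icc 0 l).norm_image_sub_le_of_norm_hasDerivWithin_le hm hmb
    (⟨le_rfl, hl.le⟩ : (0 : ℝ) ∈ Icc 0 l) (⟨hl.le, le_rfl⟩ : l ∈ Icc 0 l)
  simp only [sub_self, mul_zero, Real.sin_zero, Real.cos_zero, mul_one, zero_add, hY0, hU0,
    sub_zero, one_mul, zero_mul, add_zero, Real.norm_eq_abs, abs_of_pos hl] at hmv
  linarith

end RealSystem

/-! ### Reality of the spectral parameter and of solutions on the real axis. -/

section Positivity

variable {l : ℝ} {Q q : C(ℝ, ℝ)}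

theorem IsSys.exists_ne_zero (hl : 0 < l) {z : ℂ} {y u : ℝ → ℂ} (h : IsSys l Q q z y u)
    (hne : y 0 ≠ 0 ∨ u 0 ≠ 0) : ∃ t ∈ Icc 0 l, y t ≠ 0 := by
  by_contra! hcon
  have h0 : (0 : ℝ) ∈ Icc 0 l := ⟨le_rfl, hl.le⟩
  have hd := (uniqueDiffOn_Icc hl 0 h0).eq_deriv _ (h.deriv_fst 0 h0)
    ((hasDerivWithinAt_const 0 (Icc 0 l) (0 : ℂ)).congr hcon (hcon 0 h0))
  rw [hcon 0 h0, mul_zero, zero_add] at hd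
  rcases hne with h1 | h1
  · exact h1 (hcon 0 h0)
  · exact h1 hd

theorem IsSys.integral_normSq_pos (hl : 0 < l) {z : ℂ} {y u : ℝ → ℂ} (h : IsSys l Q q z y u)
    (hne : y 0 ≠ 0 ∨ u 0 ≠ 0) : 0 < ∫ t in (0 : ℝ)..l, Complex.normSq (y t) := by
  obtain ⟨t, ht, hyt⟩ := h.exists_ne_zero hl hne
  exact intervalIntegral.integral_pos hl
    (Complex.continuous_normSq.comp_continuousOn h.continuousOn.1)
    (fun _ _ => Complex.normSq_nonneg _) ⟨t, ht, Complex.normSq_pos.2 hyt⟩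

/-- A solution with symmetric boundary form has a real spectral parameter. -/
theorem IsSys.im_eq_zero (hl : 0 < l) {z : ℂ} {y u : ℝ → ℂ} (h : IsSys l Q q z y u)
    (hne : y 0 ≠ 0 ∨ u 0 ≠ 0)
    (hb : y l * starRingEnd ℂ (u l) - u l * starRingEnd ℂ (y l) =
      y 0 * starRingEnd ℂ (u 0) - u 0 * starRingEnd ℂ (y 0)) : z.im = 0 := by
  have hL := h.lagrange hl.le h.conj
  rw [hb, sub_self] at hL
  simp only [Complex.mul_conj] at hL
  rw [intervalIntegral.integral_ofReal] at hL
  have hpos := h.integral_normSq_pos hl hne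
  have hz : z - starRingEnd ℂ z = 0 :=
    (mul_eq_zero.1 hL.symm).resolve_right (Complex.ofReal_ne_zero.2 hpos.ne')
  exact Complex.conj_eq_iff_im.1 (sub_eq_zero.1 hz).symm

theorem sysSol_im (hl : 0 ≤ l) (x a b : ℝ) {t : ℝ} (ht : t ∈ Icc 0 l) :
    (sysSol hl Q q x ((a : ℂ), (b : ℂ)) t).1.im = 0 ∧
      (sysSol hl Q q x ((a : ℂ), (b : ℂ)) t).2.im = 0 := by
  have h := sysSol_conj hl (Q := Q) (q := q) (x : ℂ) ((a : ℂ), (b : ℂ)) ht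
  simp only [Complex.conj_ofReal] at h
  exact ⟨Complex.conj_eq_iff_im.1 (congrArg Prod.fst h).symm,
    Complex.conj_eq_iff_im.1 (congrArg Prod.snd h).symm⟩

theorem sysSol_im_sine (hl : 0 ≤ l) (x : ℝ) {t : ℝ} (ht : t ∈ Icc 0 l) :
    (sysSol hl Q q x (0, 1) t).1.im = 0 ∧ (sysSol hl Q q x (0, 1) t).2.im = 0 := by
  simpa using sysSol_im hl (Q := Q) (q := q) x 0 1 ht

theorem sysSol_im_cosine (hl : 0 ≤ l) (x : ℝ) {t : ℝ} (ht : t ∈ Icc 0 l) :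
    (sysSol hl Q q x (1, 0) t).1.im = 0 ∧ (sysSol hl Q q x (1, 0) t).2.im = 0 := by
  simpa using sysSol_im hl (Q := Q) (q := q) x 1 0 ht

end Positivity

/-! ### The zeros of `z ↦ s(l;z)`. -/

section DirichletZeros

variable {l : ℝ} {Q q : C(ℝ, ℝ)}

theorem im_eq_zero_of_dirichlet_zero (hl : 0 < l) {z : ℂ}
    (hz : (sysSol hl.le Q q z (0, 1) l).1 = 0) : z.im = 0 := by
  refine (isSys_sysSol hl.le Q q z (0, 1)).im_eq_zero hl (by simp [sysSol_zero]) ?_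
  simp [hz, sysSol_zero]

/-- Allows the limit `ζ → z` in Lagrange's identity. On `[0,l]` the solution agrees with a function
jointly continuous in `(ζ, t)`. -/
theorem continuous_integral_mul_sysSol (hl : 0 ≤ l) (z : ℂ) (v : ℂ × ℂ) :
    Continuous fun ζ => ∫ t in (0 : ℝ)..l, (sysSol hl Q q z v t).1 * (sysSol hl Q q ζ v t).1 := by
  obtain ⟨Φ, hc, hΦ⟩ : ∃ Φ : ℂ × ℝ → ℂ × ℂ, Continuous Φ ∧
      ∀ ζ : ℂ, ∀ t ∈ Icc 0 l, sysSol hl Q q ζ v t = Φ (ζ, t) := by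
    refine ⟨_, continuous_uncurry_iccExtend_volterraSol hl (sysCoeff Q q) sysParam v,
      fun ζ t ht => ?_⟩
    rw [IccExtend_of_mem _ _ ht]
    exact linSol_eq hl _ v ht
  have hJ : Continuous fun ζ => ∫ t in (0 : ℝ)..l, (Φ (z, t)).1 * (Φ (ζ, t)).1 := by
    refine intervalIntegral.continuous_parametric_intervalIntegral_of_continuous'
      (f := fun ζ t => (Φ (z, t)).1 * (Φ (ζ, t)).1) ?_ 0 l
    simp only [Function.uncurry_def]
    fun_prop
  refine hJ.congr fun ζ => intervalIntegral.integral_congr fun t ht => ?_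
  rw [uIcc_of_le hl] at ht
  simp only [hΦ _ t ht]

/-- At a Dirichlet eigenvalue the derivative of `z ↦ s(l;z)` is a positive multiple of
`s'(l;z)`. -/
theorem dirichlet_deriv_mul_pos (hl : 0 < l) {x : ℝ}
    (hx : (sysSol hl.le Q q x (0, 1) l).1 = 0) :
    0 < (sysSol hl.le Q q x (0, 1) l).2.re *
      (deriv (fun z => (sysSol hl.le Q q z (0, 1) l).1) x).re := by
  have hlm : l ∈ Icc 0 l := ⟨hl.le, le_rfl⟩
  set F : ℂ → ℂ := fun z => (sysSol hl.le Q q z (0, 1) l).1 with hF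
  set G : ℂ := (sysSol hl.le Q q x (0, 1) l).2 with hG
  set J : ℂ → ℂ := fun ζ => ∫ t in (0 : ℝ)..l,
    (sysSol hl.le Q q x (0, 1) t).1 * (sysSol hl.le Q q ζ (0, 1) t).1 with hJ
  have hFd : Differentiable ℂ F := fun z => (differentiable_sysSol hl.le (0, 1) hlm z).fst
  -- Lagrange's identity for the parameters `x` and `ζ`; dividing by `ζ - x` and letting `ζ → x`
  -- yields `G F'(x) = ∫ s²`.
  have hlag : ∀ ζ : ℂ, G * F ζ = (ζ - x) * J ζ := fun ζ => by
    have h := (isSys_sysSol hl.le Q q x (0, 1)).lagrange hl.le (isSys_sysSol hl.le Q q ζ (0, 1))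
    simp only [sysSol_zero, hx, zero_mul, mul_zero, sub_zero, zero_sub] at h
    simp only [hF, hJ, hG]
    linear_combination -h
  have hderiv : G * deriv F x = J x := by
    have h1 : Tendsto (slope (fun ζ => G * F ζ) x) (𝓝[≠] (x : ℂ)) (𝓝 (G * deriv F x)) :=
      hasDerivAt_iff_tendsto_slope.1 ((hFd x).hasDerivAt.const_mul G)
    have h2 : Tendsto J (𝓝[≠] (x : ℂ)) (𝓝 (J x)) :=
      ((continuous_integral_mul_sysSol hl.le (x : ℂ) (0, 1)).tendsto _).mono_left nhdsWithin_le_nhds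
    refine tendsto_nhds_unique (h1.congr' ?_) h2
    filter_upwards [self_mem_nhdsWithin] with ζ hζ
    have hζ' : ζ - x ≠ 0 := sub_ne_zero.2 hζ
    rw [slope_def_field, hlag ζ, hlag x, sub_self, zero_mul, sub_zero]
    field_simp
  have hJx : J x = ((∫ t in (0 : ℝ)..l,
      Complex.normSq (sysSol hl.le Q q x (0, 1) t).1 : ℝ) : ℂ) := by
    rw [← intervalIntegral.integral_ofReal]
    refine intervalIntegral.integral_congr fun t ht => ?_
    rw [uIcc_of_le hl.le] at ht
    simp only [← Complex.mul_conj]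
    rw [Complex.conj_eq_iff_im.2 (sysSol_im_sine hl.le x ht).1]
  have hpos := (isSys_sysSol hl.le Q q x (0, 1)).integral_normSq_pos hl (by simp [sysSol_zero])
  have hGim : G.im = 0 := (sysSol_im_sine hl.le x hlm).2
  have hre := congrArg Complex.re (hderiv.trans hJx)
  rw [Complex.mul_re, hGim, zero_mul, sub_zero, Complex.ofReal_re] at hre
  rw [hre]
  exact hpos

theorem exists_dirichlet_pos (hl : 0 < l) :
    ∃ x₀ : ℝ, ∀ x < x₀, 0 < (sysSol hl.le Q q x (0, 1) l).1.re := by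
  obtain ⟨x₀, hx₀⟩ := isCompact_Icc.bddBelow_image (q.continuous.continuousOn (s := Icc 0 l))
  refine ⟨x₀, fun x hx => ?_⟩
  refine (isSys_sysSol hl.le Q q x (0, 1)).re.pos_of_le hl (by simp [sysSol_zero])
    (by simp [sysSol_zero]) fun t ht => hx.le.trans (hx₀ ⟨t, ht, rfl⟩)

theorem continuous_dirichlet_re (hl : 0 < l) :
    Continuous fun x : ℝ => (sysSol hl.le Q q x (0, 1) l).1.re :=
  Complex.continuous_re.comp (continuous_fst.comp ((differentiable_sysSol hl.le (0, 1)
    ⟨hl.le, le_rfl⟩).continuous.comp Complex.continuous_ofReal))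

/-- The error `6/10` is below 1, so where `sin (k l) = ±1` the sign of the solution at `l` is
forced; a zero lies between two such frequencies. -/
theorem exists_dirichlet_zero_gt (hl : 0 < l) {ε : ℝ} (hε : 0 < ε) (hεl : ε * l ≤ 1 / 10)
    (hQ : ∀ t, |Q t| ≤ ε) (x : ℝ) : ∃ t, x < t ∧ (sysSol hl.le Q q t (0, 1) l).1.re = 0 := by
  obtain ⟨M, hM⟩ := isCompact_Icc.exists_bound_of_continuousOn
    (q.continuous.continuousOn (s := Icc 0 l))
  -- The frequencies must exceed `M / ε` for the asymptotic estimate, and both `x` and 1 so that `x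
  -- < k < k²`.
  obtain ⟨n, hn⟩ := exists_nat_gt (max (max (M / ε) x) 1 * l)
  have hmax1 : 1 ≤ max (max (M / ε) x) 1 := le_max_right _ _
  set k : ℕ → ℝ := fun j => ((2 * n + j : ℕ) * Real.pi + Real.pi / 2) / l with hkdef
  have hkl : ∀ j, k j * l = (2 * n + j : ℕ) * Real.pi + Real.pi / 2 := fun j => by
    simp only [hkdef]; field_simp
  have hkbig : ∀ j, max (max (M / ε) x) 1 < k j := fun j => by
    rw [← mul_lt_mul_iff_of_pos_right hl, hkl]
    have h3 := Real.pi_gt_three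
    have : (n : ℝ) ≤ (2 * n + j : ℕ) := by exact_mod_cast (by omega : n ≤ 2 * n + j)
    nlinarith [(Nat.cast_nonneg (2 * n + j) : (0 : ℝ) ≤ (2 * n + j : ℕ))]
  have hkpos : ∀ j, 0 < k j := fun j => by linarith [hkbig j]
  have hest : ∀ j, |k j * (sysSol hl.le Q q ((k j ^ 2 : ℝ) : ℂ) (0, 1) l).1.re -
      Real.sin (k j * l)| ≤ 6 / 10 := fun j => by
    refine (isSys_sysSol hl.le Q q ((k j ^ 2 : ℝ) : ℂ) (0, 1)).re.abs_sub_sin_le hl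
      (M := M) (by simp [sysSol_zero]) (by simp [sysSol_zero]) (hkpos j) hε hεl
      (fun t _ => hQ t) (fun t ht => hM t ht) ?_
    have h1 : M / ε < k j := ((le_max_left _ _).trans (le_max_left _ _)).trans_lt (hkbig j)
    rw [div_lt_iff₀ hε] at h1
    linarith
  have hsin0 : Real.sin (k 0 * l) = 1 := by
    rw [hkl, add_zero]
    push_cast
    rw [show (2 * (n : ℝ)) * Real.pi + Real.pi / 2 = Real.pi / 2 + n * (2 * Real.pi) by ring,
      Real.sin_add_nat_mul_two_pi, Real.sin_pi_div_two]
  have hsin1 : Real.sin (k 1 * l) = -1 := by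
    rw [hkl]
    push_cast
    rw [show (2 * (n : ℝ) + 1) * Real.pi + Real.pi / 2 =
      (Real.pi / 2 + Real.pi) + n * (2 * Real.pi) by ring,
      Real.sin_add_nat_mul_two_pi, Real.sin_add_pi, Real.sin_pi_div_two]
  have hp0 : 0 < (sysSol hl.le Q q ((k 0 ^ 2 : ℝ) : ℂ) (0, 1) l).1.re := by
    have h := hest 0
    rw [hsin0, abs_le] at h
    exact pos_of_mul_pos_right (by linarith [h.1] : 0 < k 0 * _) (hkpos 0).le
  have hn1 : (sysSol hl.le Q q ((k 1 ^ 2 : ℝ) : ℂ) (0, 1) l).1.re < 0 := by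
    have h := hest 1
    rw [hsin1, abs_le] at h
    exact neg_of_mul_neg_right (by linarith [h.2] : k 1 * _ < 0) (hkpos 1).le
  have hle : k 0 ^ 2 ≤ k 1 ^ 2 := by
    refine pow_le_pow_left₀ (hkpos 0).le ?_ 2
    simp only [hkdef]
    have := Real.pi_pos
    gcongr
    simp
  obtain ⟨t, ht, ht0⟩ := intermediate_value_Icc' hle
    (continuous_dirichlet_re (Q := Q) (q := q) hl).continuousOn
    (⟨hn1.le, hp0.le⟩ : (0 : ℝ) ∈ Icc (sysSol hl.le Q q ((k 1 ^ 2 : ℝ) : ℂ) (0, 1) l).1.re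
      (sysSol hl.le Q q ((k 0 ^ 2 : ℝ) : ℂ) (0, 1) l).1.re)
  refine ⟨t, lt_of_lt_of_le ?_ ht.1, ht0⟩
  have h1 : x < k 0 := ((le_max_right _ _).trans (le_max_left _ _)).trans_lt (hkbig 0)
  have h2 : 1 < k 0 := hmax1.trans_lt (hkbig 0)
  nlinarith

/-- The zeros of `z ↦ s(l;z)` are real and form a sequence along which `s'(l;z)` alternates in
sign. -/
theorem exists_dirichlet_zeros (hl : 0 < l) {ε : ℝ} (hε : 0 < ε) (hεl : ε * l ≤ 1 / 10)
    (hQ : ∀ t, |Q t| ≤ ε) :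
    ∃ μ : ℕ → ℝ, StrictMono μ ∧
      (∀ z : ℂ, (sysSol hl.le Q q z (0, 1) l).1 = 0 ↔ ∃ k, z = (μ k : ℂ)) ∧
      (∀ k, Even k → (sysSol hl.le Q q (μ k) (0, 1) l).2.re < 0) ∧
      ∀ k, Odd k → 0 < (sysSol hl.le Q q (μ k) (0, 1) l).2.re := by
  have hlm : l ∈ Icc 0 l := ⟨hl.le, le_rfl⟩
  have hFd : Differentiable ℂ fun z => (sysSol hl.le Q q z (0, 1) l).1 :=
    fun z => (differentiable_sysSol hl.le (0, 1) hlm z).fst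
  have hre : ∀ x : ℝ, (sysSol hl.le Q q x (0, 1) l).1.re = 0 →
      (sysSol hl.le Q q x (0, 1) l).1 = 0 := fun x hx =>
    Complex.ext hx (sysSol_im_sine hl.le x hlm).1
  obtain ⟨x₀, hx₀⟩ := exists_dirichlet_pos (Q := Q) (q := q) hl
  obtain ⟨μ, hmono, hzero, heven, hodd⟩ := exists_strictMono_zeros
    (f := fun x : ℝ => (sysSol hl.le Q q x (0, 1) l).1.re)
    (f' := fun x : ℝ => (deriv (fun z => (sysSol hl.le Q q z (0, 1) l).1) x).re)
    (g := fun x : ℝ => (sysSol hl.le Q q x (0, 1) l).2.re)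
    (fun x => (hFd x).hasDerivAt.real_of_complex)
    (fun x hx => dirichlet_deriv_mul_pos hl (hre x hx)) hx₀
    (exists_dirichlet_zero_gt hl hε hεl hQ)
  refine ⟨μ, hmono, fun z => ⟨fun hz => ?_, ?_⟩, heven, hodd⟩
  · have him := im_eq_zero_of_dirichlet_zero hl hz
    have hz' : z = (z.re : ℂ) := Complex.ext rfl (by simpa using him)
    rw [hz'] at hz
    obtain ⟨k, hk⟩ := (hzero z.re).1 (by rw [hz]; rfl)
    exact ⟨k, by rw [hz', hk]⟩
  · rintro ⟨k, rfl⟩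
    exact hre _ ((hzero _).2 ⟨k, rfl⟩)

end DirichletZeros

/-! ### Local mapping behaviour at real critical points. -/

section LocalMapping

/-- Near a point of the real axis where `f` has order at least two and positive real leading
coefficient, `f` takes real values slightly below `f x` at non-real points. -/
theorem exists_nonreal_eq_sub {f g : ℂ → ℂ} {x C : ℝ} {m : ℕ} (hm : 2 ≤ m) (hf : Continuous f)
    (hg : ContinuousAt g x) (hC : 0 < C) (hgx : g x = C)
    (hfg : ∀ᶠ z in 𝓝 (x : ℂ), f z = f x + (z - x) ^ m * g z) {δ : ℝ} (hδ : 0 < δ) :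
    ∃ z : ℂ, z.im ≠ 0 ∧ ∃ s : ℝ, 0 < s ∧ s < δ ∧ f z = f x - s := by
  have h1 : ∀ᶠ z in 𝓝 (x : ℂ), ‖g z - C‖ < C / 2 := by
    have := hg.tendsto.sub_const (C : ℂ)
    rw [hgx, sub_self] at this
    simpa using this.norm.eventually (gt_mem_nhds (by simpa using half_pos hC))
  have h2 : ∀ᶠ z in 𝓝 (x : ℂ), ‖f z - f x‖ < δ := by
    have := (hf.tendsto (x : ℂ)).sub_const (f x)
    rw [sub_self] at this
    simpa using this.norm.eventually (gt_mem_nhds (by simpa using hδ))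
  obtain ⟨r₀, hr₀, hball⟩ := Metric.eventually_nhds_iff.1 (hfg.and (h1.and h2))
  set r := r₀ / 2 with hr
  have hr0 : 0 < r := half_pos hr₀
  set ζ : ℝ → ℂ := fun θ => x + r * Complex.exp (θ * Complex.I) with hζ
  have hζb : ∀ θ, f (ζ θ) = f x + (ζ θ - x) ^ m * g (ζ θ) ∧ ‖g (ζ θ) - C‖ < C / 2 ∧
      ‖f (ζ θ) - f x‖ < δ := fun θ => hball (by
    rw [dist_eq_norm]
    simp only [hζ, add_sub_cancel_left, norm_mul, Complex.norm_exp_ofReal_mul_I, mul_one,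
      Complex.norm_real, Real.norm_eq_abs, abs_of_pos hr0]
    linarith)
  have hval : ∀ θ, f (ζ θ) - f x =
      ((r ^ m : ℝ) : ℂ) * (Complex.exp (((m * θ : ℝ) : ℂ) * Complex.I) * g (ζ θ)) := fun θ => by
    rw [(hζb θ).1]
    simp only [hζ, add_sub_cancel_left, mul_pow, ← Complex.exp_nat_mul]
    push_cast
    ring_nf
  have hgre : ∀ θ, 0 < (g (ζ θ)).re := fun θ => by
    have := (Complex.abs_re_le_norm (g (ζ θ) - C)).trans_lt (hζb θ).2.1
    rw [Complex.sub_re, Complex.ofReal_re, abs_lt] at this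
    linarith [this.1]
  have hm0 : (0 : ℝ) < m := by exact_mod_cast (by omega : 0 < m)
  have hm2 : (2 : ℝ) ≤ m := by exact_mod_cast hm
  have hpi := Real.pi_pos
  have hrm : 0 < r ^ m := pow_pos hr0 m
  -- For `θ` from `a` to `b` the angle `mθ` runs from `π/2` to `3π/2`: the imaginary part of `f - f
  -- x` changes sign while `cos (mθ) ≤ 0`. Since `m ≥ 2`, `b < π` and the arc stays in the open
  -- upper half-plane.
  set a := Real.pi / 2 / m with ha
  set b := (Real.pi / 2 + Real.pi) / m with hb
  have hma : (m : ℝ) * a = Real.pi / 2 := by rw [ha]; field_simp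
  have hmb : (m : ℝ) * b = Real.pi / 2 + Real.pi := by rw [hb]; field_simp
  have hab : a ≤ b := by rw [ha, hb]; gcongr; linarith
  have hcont : Continuous fun θ => (f (ζ θ) - f x).im := by
    have : Continuous ζ := by simp only [hζ]; fun_prop
    fun_prop
  have hexpi : Complex.exp (((Real.pi / 2 : ℝ) : ℂ) * Complex.I) = Complex.I := by
    push_cast; exact Complex.exp_pi_div_two_mul_I
  have hexpi' : Complex.exp (((Real.pi / 2 + Real.pi : ℝ) : ℂ) * Complex.I) = -Complex.I := by
    push_cast
    rw [add_mul, Complex.exp_add, Complex.exp_pi_div_two_mul_I, Complex.exp_pi_mul_I]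
    ring
  have hfa : 0 ≤ (f (ζ a) - f x).im := by
    rw [hval, hma, hexpi, Complex.im_ofReal_mul, Complex.I_mul_im]
    exact (mul_pos hrm (hgre a)).le
  have hfb : (f (ζ b) - f x).im ≤ 0 := by
    rw [hval, hmb, hexpi', Complex.im_ofReal_mul, neg_mul, Complex.neg_im, Complex.I_mul_im]
    have := mul_pos hrm (hgre b)
    linarith
  obtain ⟨θ, hθ, hθ0⟩ := intermediate_value_Icc' hab hcont.continuousOn
    (⟨hfb, hfa⟩ : (0 : ℝ) ∈ Icc (f (ζ b) - f x).im (f (ζ a) - f x).im)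
  simp only at hθ0
  set ψ := Complex.exp (((m * θ : ℝ) : ℂ) * Complex.I) * g (ζ θ) with hψ
  have hψim : ψ.im = 0 := by
    rw [hval, Complex.im_ofReal_mul] at hθ0
    exact (mul_eq_zero.1 hθ0).resolve_left hrm.ne'
  have hmθ : Real.pi / 2 ≤ m * θ ∧ m * θ ≤ Real.pi / 2 + Real.pi := by
    rw [← hmb, ← hma]
    exact ⟨mul_le_mul_of_nonneg_left hθ.1 hm0.le, mul_le_mul_of_nonneg_left hθ.2 hm0.le⟩
  have hcos : Real.cos (m * θ) ≤ 0 :=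
    Real.cos_nonpos_of_pi_div_two_le_of_le hmθ.1 (by linarith [hmθ.2])
  -- `ψ` is real with `ψ ≤ C/2` and `|ψ| > C/2`, so it must be negative.
  have hψre : ψ.re ≤ C / 2 := by
    have e : ψ = Complex.exp (((m * θ : ℝ) : ℂ) * Complex.I) * C +
        Complex.exp (((m * θ : ℝ) : ℂ) * Complex.I) * (g (ζ θ) - C) := by rw [hψ]; ring
    have e1 : (Complex.exp (((m * θ : ℝ) : ℂ) * Complex.I) * C).re ≤ 0 := by
      rw [Complex.re_mul_ofReal, Complex.exp_ofReal_mul_I_re]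
      exact mul_nonpos_of_nonpos_of_nonneg hcos hC.le
    have e2 := Complex.re_le_norm (Complex.exp (((m * θ : ℝ) : ℂ) * Complex.I) * (g (ζ θ) - C))
    rw [norm_mul, Complex.norm_exp_ofReal_mul_I, one_mul] at e2
    rw [e, Complex.add_re]
    linarith [(hζb θ).2.1]
  have hψnorm : C / 2 < ‖ψ‖ := by
    rw [hψ, norm_mul, Complex.norm_exp_ofReal_mul_I, one_mul]
    have := norm_sub_norm_le (C : ℂ) (g (ζ θ))
    rw [Complex.norm_real, Real.norm_eq_abs, abs_of_pos hC, norm_sub_rev] at this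
    linarith [(hζb θ).2.1]
  have hψeq : ψ = (ψ.re : ℂ) := Complex.ext rfl (by simpa using hψim)
  have hψneg : ψ.re < 0 := by
    rw [hψeq, Complex.norm_real, Real.norm_eq_abs] at hψnorm
    by_contra hcon
    rw [abs_of_nonneg (not_lt.1 hcon)] at hψnorm
    linarith
  have hfin : f (ζ θ) - f x = -((-(r ^ m * ψ.re) : ℝ) : ℂ) := by
    rw [hval, ← hψ, hψeq]
    push_cast
    simp
  refine ⟨ζ θ, ?_, -(r ^ m * ψ.re), by nlinarith [mul_pos hrm (neg_pos.2 hψneg)], ?_, ?_⟩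
  · have hθpos : 0 < θ := lt_of_lt_of_le (by positivity) hθ.1
    have hθpi : θ < Real.pi := by nlinarith [hmθ.2]
    simp only [hζ, Complex.add_im, Complex.ofReal_im, zero_add, Complex.im_ofReal_mul,
      Complex.exp_ofReal_mul_I_im]
    exact (mul_pos hr0 (Real.sin_pos_of_pos_of_lt_pi hθpos hθpi)).ne'
  · have := (hζb θ).2.2
    rw [hfin, norm_neg, Complex.norm_real, Real.norm_eq_abs] at this
    exact (le_abs_self _).trans_lt this
  · rw [sub_eq_add_neg, ← hfin]
    ring

/-- An entire function, real on the real axis, that takes values in `[-B, B]` only on the real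
axis. -/
structure IsLyapunov (B : ℝ) (f : ℂ → ℂ) : Prop where
  differentiable : Differentiable ℂ f
  real : ∀ x : ℝ, (f x).im = 0
  im_eq_zero : ∀ z, (f z).im = 0 → |(f z).re| ≤ B → z.im = 0

variable {B : ℝ} {f : ℂ → ℂ}

theorem IsLyapunov.neg (h : IsLyapunov B f) : IsLyapunov B (fun z => -f z) where
  differentiable := h.differentiable.neg
  real x := by simp [h.real]
  im_eq_zero z h1 h2 := h.im_eq_zero z (by simpa using h1) (by simpa using h2)

/-- If `f` were locally constant, it would take the value `f x`, which lies in `[-B,B]`, off the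
axis. So `f - f x` has finite order, and orders 0 and 1 are excluded by `f x - f x = 0` and `f' x =
0`. -/
theorem IsLyapunov.exists_factor (h : IsLyapunov B f) {x : ℝ} (hx : |(f x).re| ≤ B)
    (hd : deriv f x = 0) : ∃ (m : ℕ) (g : ℂ → ℂ) (C : ℝ), 2 ≤ m ∧ ContinuousAt g x ∧ C ≠ 0 ∧
      g x = C ∧ ∀ᶠ z in 𝓝 (x : ℂ), f z = f x + (z - x) ^ m * g z := by
  have han : AnalyticAt ℂ (fun z => f z - f x) x :=
    (h.differentiable.sub_const (f x)).analyticAt x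
  have hne : ¬ ∀ᶠ z in 𝓝 (x : ℂ), f z - f x = 0 := by
    intro hcon
    obtain ⟨r, hr, hb⟩ := Metric.eventually_nhds_iff.1 hcon
    have hz := hb (y := x + ((r / 2 : ℝ) : ℂ) * Complex.I) (by
      rw [dist_eq_norm, add_sub_cancel_left, norm_mul, Complex.norm_I, mul_one, Complex.norm_real,
        Real.norm_eq_abs, abs_of_pos (half_pos hr)]
      linarith)
    rw [sub_eq_zero] at hz
    have := h.im_eq_zero _ (by rw [hz]; exact h.real x) (by rw [hz]; exact hx)
    simp at this
    linarith
  obtain ⟨m, g, hg, hg0, hfac⟩ := han.exists_eventuallyEq_pow_smul_nonzero_iff.2 hne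
  have hfac' : ∀ᶠ z in 𝓝 (x : ℂ), f z = f x + (z - x) ^ m * g z :=
    hfac.mono fun z hz => by rw [smul_eq_mul] at hz; linear_combination hz
  -- For real `t > x`, `g t` is the quotient of the real numbers `f t - f x` and `(t - x) ^ m`.
  have hgim : (g x).im = 0 := by
    have ht : Tendsto (fun t : ℝ => (g t).im) (𝓝[>] x) (𝓝 (g x).im) :=
      (Complex.continuous_im.continuousAt.tendsto.comp (hg.continuousAt.tendsto.comp
        (Complex.continuous_ofReal.tendsto x))).mono_left nhdsWithin_le_nhds
    refine tendsto_nhds_unique (ht.congr' ?_) tendsto_const_nhds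
    have hev := (Complex.continuous_ofReal.tendsto x).eventually hfac'
    filter_upwards [hev.filter_mono nhdsWithin_le_nhds, self_mem_nhdsWithin] with t ht htx
    have htx' : (0 : ℝ) < t - x := sub_pos.2 htx
    have him := congrArg Complex.im ht
    rw [Complex.add_im, h.real, h.real, zero_add, ← Complex.ofReal_sub, ← Complex.ofReal_pow,
      Complex.im_ofReal_mul] at him
    exact (mul_eq_zero.1 him.symm).resolve_left (pow_pos htx' m).ne'
  have hgx : g x = ((g x).re : ℂ) := Complex.ext rfl (by simpa using hgim)
  refine ⟨m, g, (g x).re, ?_, hg.continuousAt, fun h0 => hg0 (by rw [hgx, h0]; rfl), hgx, hfac'⟩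
  by_contra hm
  interval_cases m
  · have := hfac'.self_of_nhds
    simp [hg0] at this
  · have h1 : HasDerivAt (fun z : ℂ => f x + (z - x) ^ 1 * g z) (g x) x := by
      have := ((((hasDerivAt_id (x : ℂ)).sub_const (x : ℂ)).mul
        hg.differentiableAt.hasDerivAt).const_add (f x))
      simpa using this
    have h2 := (h1.congr_of_eventuallyEq hfac').deriv
    exact hg0 (h2 ▸ hd)

/-- At a critical point, non-real points carry real values slightly below `f x` (or above it,
through `-f`, if the leading coefficient is negative). The strict inequality leaves room for these
values in `[-B,B]`. -/
theorem IsLyapunov.deriv_ne_zero (h : IsLyapunov B f) {x : ℝ} (hx : |(f x).re| < B) :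
    deriv f x ≠ 0 := by
  intro hd
  obtain ⟨m, g, C, hm, hg, hC, hgx, hfac⟩ := h.exists_factor hx.le hd
  have hx' := abs_lt.1 hx
  rcases lt_or_gt_of_ne hC with hC | hC
  · obtain ⟨z, hz, s, hs, hsδ, hfz⟩ := exists_nonreal_eq_sub (f := fun z => -f z)
      (g := fun z => -g z) hm h.differentiable.continuous.neg hg.neg (neg_pos.2 hC)
      (by rw [hgx]; push_cast; rfl) (hfac.mono fun z hz => by rw [hz]; ring)
      (by linarith : 0 < B - (f x).re)
    refine hz (h.neg.im_eq_zero z (by rw [hfz]; simp [h.real]) ?_)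
    rw [hfz]
    simp only [Complex.sub_re, Complex.neg_re, Complex.ofReal_re, abs_le]
    constructor <;> linarith
  · obtain ⟨z, hz, s, hs, hsδ, hfz⟩ := exists_nonreal_eq_sub hm h.differentiable.continuous hg hC
      hgx hfac (by linarith : 0 < B + (f x).re)
    refine hz (h.im_eq_zero z (by rw [hfz]; simp [h.real]) ?_)
    rw [hfz]
    simp only [Complex.sub_re, Complex.ofReal_re, abs_le]
    constructor <;> linarith

/-- A minimum forces a positive leading coefficient, as seen from the right where `(t - x) ^ m > 0`.
Values slightly below `B` are then taken at non-real points. -/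
theorem IsLyapunov.ne_of_isLocalMin (h : IsLyapunov B f) (hB : 0 < B) {x : ℝ}
    (hmin : IsLocalMin (fun t : ℝ => (f t).re) x) : (f x).re ≠ B := by
  intro hfx
  have hd : deriv f x = 0 := by
    have hD := (h.differentiable x).hasDerivAt
    refine Complex.ext (hmin.hasDerivAt_eq_zero hD.real_of_complex) ?_
    have h1 := Complex.imCLM.hasFDerivAt.comp_hasDerivAt x hD.comp_ofReal
    have h2 : (Complex.imCLM ∘ fun t : ℝ => f t) = fun _ => (0 : ℝ) := by
      ext t; exact h.real t
    rw [h2] at h1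
    exact h1.unique (hasDerivAt_const x 0)
  obtain ⟨m, g, C, hm, hg, hC, hgx, hfac⟩ := h.exists_factor (by rw [hfx, abs_of_pos hB]) hd
  rcases lt_or_gt_of_ne hC with hC | hC
  · have hgneg : ∀ᶠ t : ℝ in 𝓝 x, (g t).re < 0 := by
      have ht : Tendsto (fun t : ℝ => (g t).re) (𝓝 x) (𝓝 (g x).re) :=
        Complex.continuous_re.continuousAt.tendsto.comp (hg.tendsto.comp
          (Complex.continuous_ofReal.tendsto x))
      exact ht.eventually (gt_mem_nhds (by rw [hgx]; exact hC))
    have hev := (Complex.continuous_ofReal.tendsto x).eventually hfac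
    have hall : ∀ᶠ t : ℝ in 𝓝[>] x, (g t).re < 0 ∧ f t = f x + ((t : ℂ) - x) ^ m * g t ∧
        (f x).re ≤ (f t).re := (hgneg.and (hev.and hmin)).filter_mono nhdsWithin_le_nhds
    obtain ⟨t, ⟨ht1, ht2, ht3⟩, ht⟩ := (hall.and self_mem_nhdsWithin).exists
    have htx' : (0 : ℝ) < t - x := sub_pos.2 ht
    have hre := congrArg Complex.re ht2
    rw [Complex.add_re, ← Complex.ofReal_sub, ← Complex.ofReal_pow, Complex.re_ofReal_mul] at hre
    have := mul_neg_of_pos_of_neg (pow_pos htx' m) ht1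
    linarith
  -- The margin `2 * B` keeps `B - s` above `-B`.
  · obtain ⟨z, hz, s, hs, hsδ, hfz⟩ := exists_nonreal_eq_sub hm h.differentiable.continuous hg hC
      hgx hfac (by linarith : 0 < 2 * B)
    refine hz (h.im_eq_zero z (by rw [hfz]; simp [h.real]) ?_)
    rw [hfz]
    simp only [Complex.sub_re, Complex.ofReal_re, abs_le]
    constructor <;> linarith

theorem IsLyapunov.ne_of_isLocalMax (h : IsLyapunov B f) (hB : 0 < B) {x : ℝ}
    (hmax : IsLocalMax (fun t : ℝ => (f t).re) x) : (f x).re ≠ -B := by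
  have := h.neg.ne_of_isLocalMin hB (x := x) (by simpa using hmax.neg)
  intro hx
  exact this (by simp [hx])

end LocalMapping

/-! ### The fundamental system of the original equation. -/

section FundamentalSystem

/-- `c, s` are the solutions on `[0,l]` with `c(0) = s'(0) = 1` and `c'(0) = s(0) = 0`, and
`dc, ds` are their derivatives. -/
structure IsFund (l : ℝ) (V : ℝ → ℝ) (c dc s ds : ℂ → ℝ → ℂ) : Prop where
  sol : ∀ z a b, IsSolution 0 l V z (fun t => a * c z t + b * s z t)
    (fun t => a * dc z t + b * ds z t)
  c_zero : ∀ z, c z 0 = 1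
  dc_zero : ∀ z, dc z 0 = 0
  s_zero : ∀ z, s z 0 = 0
  ds_zero : ∀ z, ds z 0 = 1
  rep : ∀ z y p, IsSolution 0 l V z y p → ∀ t ∈ Icc 0 l,
    y t = y 0 * c z t + p 0 * s z t ∧ p t = y 0 * dc z t + p 0 * ds z t
  wronskian : ∀ z, c z l * ds z l - dc z l * s z l = 1
  differentiable_c : Differentiable ℂ fun z => c z l
  differentiable_s : Differentiable ℂ fun z => s z l
  differentiable_ds : Differentiable ℂ fun z => ds z l
  real_c : ∀ x : ℝ, (c x l).im = 0
  real_s : ∀ x : ℝ, (s x l).im = 0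
  real_ds : ∀ x : ℝ, (ds x l).im = 0
  im_eq_zero : ∀ z y p, IsSolution 0 l V z y p → (y 0 ≠ 0 ∨ p 0 ≠ 0) →
    y l * starRingEnd ℂ (p l) - p l * starRingEnd ℂ (y l) =
      y 0 * starRingEnd ℂ (p 0) - p 0 * starRingEnd ℂ (y 0) → z.im = 0

/-- Returning from `u` to `p = u + Q y` keeps the initial data because `Q 0 = 0`, the Wronskian
because the `Q` terms cancel, and the boundary form because `Q` is real. -/
theorem isFund_sysSol {l : ℝ} (hl : 0 < l) {V : ℝ → ℝ}
    (hV : MemLp V 2 (volume.restrict (Icc 0 l))) {Q w : C(ℝ, ℝ)} (hR : IsReg l V Q w) :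
    IsFund l V (fun z t => (sysSol hl.le Q (w - Q * Q) z (1, 0) t).1)
      (fun z t => (sysSol hl.le Q (w - Q * Q) z (1, 0) t).2 +
        (Q t : ℂ) * (sysSol hl.le Q (w - Q * Q) z (1, 0) t).1)
      (fun z t => (sysSol hl.le Q (w - Q * Q) z (0, 1) t).1)
      (fun z t => (sysSol hl.le Q (w - Q * Q) z (0, 1) t).2 +
        (Q t : ℂ) * (sysSol hl.le Q (w - Q * Q) z (0, 1) t).1) := by
  have hQ0 : Q 0 = 0 := hR.zero hl.le
  have hlm : l ∈ Icc 0 l := ⟨hl.le, le_rfl⟩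
  have hd1 : ∀ v, Differentiable ℂ fun z => (sysSol hl.le Q (w - Q * Q) z v l).1 :=
    fun v z => (differentiable_sysSol hl.le v hlm z).fst
  have hd2 : ∀ v, Differentiable ℂ fun z => (sysSol hl.le Q (w - Q * Q) z v l).2 :=
    fun v z => (differentiable_sysSol hl.le v hlm z).snd
  refine ⟨fun z a b => ?_, fun z => by simp [sysSol_zero], fun z => by simp [sysSol_zero, hQ0],
    fun z => by simp [sysSol_zero], fun z => by simp [sysSol_zero, hQ0], fun z y p h t ht => ?_,
    fun z => ?_, hd1 _, hd1 _, (hd2 _).add ((hd1 _).const_mul _),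
    fun x => (sysSol_im_cosine hl.le x hlm).1, fun x => (sysSol_im_sine hl.le x hlm).1,
    fun x => ?_, fun z y p h hne hb => ?_⟩
  · have h := (((isSys_sysSol hl.le Q (w - Q * Q) z (1, 0)).comb
      (isSys_sysSol hl.le Q (w - Q * Q) z (0, 1)) a b).isSolution hl.le hV hR)
    refine cast (congrArg (IsSolution 0 l V z _) (funext fun t => ?_)) h
    ring
  · have h1 := (h.isSys hl.le hR).eq_sysSol hl.le ht
    rw [sysSol_comb hl.le z _ _ ht] at h1
    have hy := congrArg Prod.fst h1
    have hu := congrArg Prod.snd h1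
    simp only [hQ0, Complex.ofReal_zero, zero_mul, sub_zero] at hy hu
    exact ⟨hy, by linear_combination hu + (Q t : ℂ) * hy⟩
  · linear_combination wronskian_sysSol hl.le (Q := Q) (q := w - Q * Q) z
  · simp [(sysSol_im_sine hl.le x hlm).1, (sysSol_im_sine hl.le x hlm).2]
  · refine (h.isSys hl.le hR).im_eq_zero hl (by simpa [hQ0] using hne) ?_
    simp only [map_sub, map_mul, Complex.conj_ofReal, hQ0]
    linear_combination hb

theorem exists_isFund {l : ℝ} (hl : 0 < l) {V : ℝ → ℝ}
    (hV : MemLp V 2 (volume.restrict (Icc 0 l))) :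
    ∃ c dc s ds : ℂ → ℝ → ℂ, IsFund l V c dc s ds ∧ ∃ μ : ℕ → ℝ, StrictMono μ ∧
      (∀ z : ℂ, s z l = 0 ↔ ∃ k, z = (μ k : ℂ)) ∧
      (∀ k, Even k → (ds (μ k) l).re < 0) ∧ ∀ k, Odd k → 0 < (ds (μ k) l).re := by
  obtain ⟨Q, w, hR, hQ⟩ := exists_isReg hl.le hV (ε := 1 / (10 * l)) (by positivity)
  obtain ⟨μ, hmono, hzero, heven, hodd⟩ := exists_dirichlet_zeros (q := w - Q * Q) hl
    (by positivity) (by field_simp; norm_num) hQ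
  have hz : ∀ k, (sysSol hl.le Q (w - Q * Q) (μ k) (0, 1) l).1 = 0 := fun k =>
    (hzero _).2 ⟨k, rfl⟩
  refine ⟨_, _, _, _, isFund_sysSol hl hV hR, μ, hmono, hzero, fun k hk => ?_, fun k hk => ?_⟩
  -- At a Dirichlet zero `y(l) = 0`, so derivative and quasi-derivative coincide at `l`.
  · simpa [hz k] using heven k hk
  · simpa [hz k] using hodd k hk

variable {l : ℝ} {V : ℝ → ℝ} {c dc s ds : ℂ → ℝ → ℂ}

theorem IsFund.sol_s (h : IsFund l V c dc s ds) (z : ℂ) : IsSolution 0 l V z (s z) (ds z) := by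
  simpa using h.sol z 0 1

end FundamentalSystem

/-! ### Eigenvalues of the Dirichlet operator. -/

section Dirichlet

variable {l : ℝ} {V : ℝ → ℝ} {c dc s ds : ℂ → ℝ → ℂ}

theorem IsFund.exists_eigenvector (h : IsFund l V c dc s ds) (hl : 0 < l) {z : ℂ}
    (hz : s z l = 0) : ∃ u : L2 l, u ≠ 0 ∧ (u, z • u) ∈ (dirichletOp l V).graph := by
  rw [dirichletOp_graph hl]
  obtain ⟨g, hg, hae⟩ := h.sol_s z
  have hyc : ContinuousOn (s z) (Icc 0 l) := fun t ht => (hg.hasDeriv t ht).continuousWithinAt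
  have hmem : MemLp (s z) 2 (volume.restrict (Icc 0 l)) := by
    obtain ⟨C, hC⟩ := isCompact_Icc.exists_bound_of_continuousOn hyc
    exact MemLp.of_bound (hyc.aestronglyMeasurable measurableSet_Icc) C
      ((ae_restrict_iff' measurableSet_Icc).2 (ae_of_all _ hC))
  refine ⟨hmem.toLp (s z), fun h0 => ?_, s z, ds z, g, hg, h.s_zero z, hz, hmem.coeFn_toLp, ?_⟩
  · have hy0 : s z =ᵐ[volume.restrict (Icc 0 l)] (fun _ => (0 : ℂ)) := by
      have h1 := hmem.coeFn_toLp
      rw [h0] at h1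
      exact h1.symm.trans (Lp.coeFn_zero ℂ 2 _)
    have hy : EqOn (s z) (fun _ => (0 : ℂ)) (Icc 0 l) :=
      Measure.eqOn_Icc_of_ae_eq volume hl.ne hy0 hyc continuousOn_const
    have h0m : (0 : ℝ) ∈ Icc 0 l := ⟨le_rfl, hl.le⟩
    have hd := (uniqueDiffOn_Icc hl 0 h0m).eq_deriv _ (hg.hasDeriv 0 h0m)
      ((hasDerivWithinAt_const 0 _ (0 : ℂ)).congr hy (hy h0m))
    rw [h.ds_zero] at hd
    exact one_ne_zero hd
  · filter_upwards [Lp.coeFn_smul z (hmem.toLp (s z)), hmem.coeFn_toLp, hae] with t h1 h2 h3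
    simp only [h1, Pi.smul_apply, h2, smul_eq_mul]
    exact h3.symm

theorem IsFund.isEigenvalue_iff (h : IsFund l V c dc s ds) (hl : 0 < l) (z : ℂ) :
    IsEigenvalue (dirichletOp l V) z ↔ s z l = 0 := by
  constructor
  · rintro ⟨u, hu, huz⟩
    have hgr : ((u : L2 l), z • (u : L2 l)) ∈ dirichletGraph l V := by
      rw [← dirichletOp_graph hl, ← huz]
      exact (dirichletOp l V).mem_graph u
    obtain ⟨y, p, g, hg, hy0, hyl, huy, huv⟩ := hgr
    have hsol : IsSolution 0 l V z y p := by
      refine ⟨g, hg, ?_⟩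
      filter_upwards [huy, huv, Lp.coeFn_smul z (u : L2 l)] with t h1 h2 h3
      rw [← h2, ← h1]
      simp only [h3, Pi.smul_apply, smul_eq_mul]
    have hrep := fun t ht => (h.rep z y p hsol t ht).1
    simp only [hy0, zero_mul, zero_add] at hrep
    have hl0 := hrep l ⟨hl.le, le_rfl⟩
    rw [hyl] at hl0
    refine (mul_eq_zero.1 hl0.symm).resolve_left fun hp0 => hu ?_
    refine Subtype.ext (Lp.ext ?_)
    have hy : ∀ᵐ t ∂(volume.restrict (Icc 0 l)), y t = 0 :=
      (ae_restrict_iff' measurableSet_Icc).2 (ae_of_all _ fun t ht => by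
        rw [hrep t ht, hp0, zero_mul])
    filter_upwards [huy, hy, Lp.coeFn_zero ℂ 2 (volume.restrict (Icc (0 : ℝ) l))] with t h1 h2 h3
    simp only [h1, h2]
    exact h3.symm
  · intro hz
    obtain ⟨u, hu, hgr⟩ := h.exists_eigenvector hl hz
    obtain ⟨v, hv1, hv2⟩ := LinearPMap.mem_graph_iff _ |>.1 hgr
    refine ⟨v, fun h0 => hu ?_, ?_⟩
    · simp only at hv1
      rw [← hv1, h0]
      rfl
    · simp only at hv1 hv2
      rw [hv2, hv1]

/-- Only the inclusion of the eigenvalues in the spectrum is needed: a resolvent at `z` would send 0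
to the eigenvector. -/
theorem IsFund.ne_zero_of_notMem_spec (h : IsFund l V c dc s ds) (hl : 0 < l) {z : ℂ}
    (hz : z ∉ spec (dirichletOp l V)) : s z l ≠ 0 := by
  intro h0
  obtain ⟨u, hu, hgr⟩ := h.exists_eigenvector hl h0
  obtain ⟨R, hR⟩ := not_not.1 hz
  exact hu (by simpa using (hR u 0).1 (by simpa using hgr))

end Dirichlet

/-! ### The Krein matrix in terms of the fundamental system. -/

section Krein

variable {l : ℝ} {V : ℝ → ℝ} {c dc s ds : ℂ → ℝ → ℂ}

theorem IsKreinMatrix.unique {z : ℂ} {S T : Matrix (Fin 2) (Fin 2) ℂ} (hS : IsKreinMatrix l V z S)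
    (hT : IsKreinMatrix l V z T) : S = T := by
  refine Matrix.ext_of_mulVec_single fun i => ?_
  obtain ⟨f, p, hf, hfc⟩ := hS.1 (Pi.single i 1)
  rw [← hfc, ← hS.2 f p hf, ← hT.2 f p hf]

/-- Solve `f(l) = f(0) c + f'(0) s` for `f'(0)`; the Wronskian reduces the lower left entry to
`1/s`. -/
theorem IsFund.isKreinMatrix (h : IsFund l V c dc s ds) (hl : 0 < l) {z : ℂ} (hz : s z l ≠ 0) :
    IsKreinMatrix l V z
      !![-c z l / s z l, 1 / s z l; 1 / s z l, -ds z l / s z l] := by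
  refine ⟨fun v => ?_, fun f p hf => ?_⟩
  · refine ⟨_, _, h.sol z (v 0) ((v 1 - v 0 * c z l) / s z l), ?_⟩
    ext i
    fin_cases i
    · simp [h.c_zero, h.s_zero]
    · simp
      field_simp
      ring
  · obtain ⟨h1, h2⟩ := h.rep z f p hf l ⟨hl.le, le_rfl⟩
    have hW := h.wronskian z
    have hp0 : p 0 = (f l - f 0 * c z l) / s z l := by
      field_simp
      linear_combination -h1
    ext i
    fin_cases i
    · simp [Matrix.mulVec, dotProduct, Fin.sum_univ_two]
      rw [hp0]
      field_simp
      ring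
    · simp [Matrix.mulVec, dotProduct, Fin.sum_univ_two]
      rw [h2, hp0]
      field_simp
      linear_combination (f 0) * hW

theorem IsFund.isKreinMatrix_kreinMatrix (h : IsFund l V c dc s ds) (hl : 0 < l) {z : ℂ}
    (hz : s z l ≠ 0) : IsKreinMatrix l V z (kreinMatrix l V z) := by
  have hex : ∃ S, IsKreinMatrix l V z S := ⟨_, h.isKreinMatrix hl hz⟩
  rw [kreinMatrix, dif_pos hex]
  exact hex.choose_spec

theorem IsFund.kreinMatrix_eq (h : IsFund l V c dc s ds) (hl : 0 < l) {z : ℂ}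
    (hz : s z l ≠ 0) : kreinMatrix l V z =
      !![-c z l / s z l, 1 / s z l; 1 / s z l, -ds z l / s z l] :=
  (h.isKreinMatrix_kreinMatrix hl hz).unique (h.isKreinMatrix hl hz)

theorem IsFund.kreinEta_eq (h : IsFund l V c dc s ds) (hl : 0 < l) (α β : ℝ) {z : ℂ}
    (hz : s z l ≠ 0) : kreinEta l V α β z =
      α * s z l + (1 + (β : ℂ) ^ 2) * (c z l + ds z l) := by
  rw [kreinEta, h.kreinMatrix_eq hl hz]
  simp
  field_simp
  ring

end Krein

/-! ### The Kronig–Penney operator, its monodromy matrix and its discriminant. -/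

section Monodromy

variable {l : ℝ} {V : ℝ → ℝ} {c dc s ds : ℂ → ℝ → ℂ}

theorem IsSolution.congr_potential {a b : ℝ} {W W' : ℝ → ℝ} {z : ℂ} {y p : ℝ → ℂ}
    (h : IsSolution a b W z y p) (hW : ∀ t ∈ Ico a b, W t = W' t) : IsSolution a b W' z y p := by
  obtain ⟨g, hg, hae⟩ := h
  refine ⟨g, hg, ?_⟩
  rw [← Measure.restrict_congr_set Ico_ae_eq_Icc] at hae ⊢
  filter_upwards [hae, ae_restrict_mem measurableSet_Ico] with t h1 h2
  rw [← hW t h2]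
  exact h1

theorem IsSolution.congr {a b : ℝ} {W : ℝ → ℝ} {z : ℂ} {y y' p : ℝ → ℂ}
    (h : IsSolution a b W z y p) (hy : EqOn y' y (Icc a b)) : IsSolution a b W z y' p := by
  obtain ⟨g, hg, hae⟩ := h
  refine ⟨g, ⟨hg.memLp, fun t ht => (hg.hasDeriv t ht).congr hy (hy ht), hg.deriv_eq⟩, ?_⟩
  filter_upwards [hae, ae_restrict_mem measurableSet_Icc] with t h1 h2
  rw [hy h2]
  exact h1

theorem IsSolution.translate {a b : ℝ} {W : ℝ → ℝ} {z : ℂ} {y p : ℝ → ℂ}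
    (h : IsSolution a b W z y p) (d : ℝ) :
    IsSolution (a + d) (b + d) (fun t => W (t - d)) z (fun t => y (t - d))
      (fun t => p (t - d)) := by
  obtain ⟨g, hg, hae⟩ := h
  have hpre : (fun t => t - d) ⁻¹' Icc a b = Icc (a + d) (b + d) := preimage_sub_const_Icc _ _ _
  have hmp : MeasurePreserving (fun t => t - d) (volume.restrict (Icc (a + d) (b + d)))
      (volume.restrict (Icc a b)) := by
    rw [← hpre]
    exact (measurePreserving_sub_right volume d).restrict_preimage measurableSet_Icc
  have hmem : ∀ t ∈ Icc (a + d) (b + d), t - d ∈ Icc a b := fun t ht => by rwa [← hpre] at ht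
  refine ⟨fun t => g (t - d), ⟨hg.memLp.comp_measurePreserving hmp, fun t ht => ?_,
    fun t ht => ?_⟩, hmp.quasiMeasurePreserving.ae hae⟩
  · have h1 := (hg.hasDeriv (t - d) (hmem t ht)).scomp t
      ((hasDerivAt_id t).sub_const d).hasDerivWithinAt (fun x hx => hmem x hx)
    exact h1.congr_deriv (one_smul _ _)
  · simp only [add_sub_cancel_right]
    rw [intervalIntegral.integral_comp_sub_right, add_sub_cancel_right]
    exact hg.deriv_eq _ (hmem t ht)

theorem periodize_of_mem (hl : 0 < l) (V : ℝ → ℝ) (k : ℤ) {t : ℝ}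
    (ht : t ∈ Ico (k * l) ((k + 1) * l)) : periodize l V t = V (t - k * l) := by
  have hf : ⌊t / l⌋ = k := by
    rw [Int.floor_eq_iff, le_div_iff₀ hl, div_lt_iff₀ hl]
    exact ht
  rw [periodize, Int.fract, hf]
  congr 1
  field_simp

/-- The monodromy matrix in terms of the fundamental system on `[0,l]`. -/
def fundMonodromy (l a : ℝ) (c dc s ds : ℂ → ℝ → ℂ) (z : ℂ) : Matrix (Fin 2) (Fin 2) ℂ :=
  !![ds z l + a * s z l, dc z l + a * c z l; s z l, c z l]

theorem IsFund.det_fundMonodromy (h : IsFund l V c dc s ds) (a : ℝ) (z : ℂ) :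
    (fundMonodromy l a c dc s ds z).det = 1 := by
  rw [fundMonodromy, Matrix.det_fin_two_of]
  linear_combination h.wronskian z

theorem IsFund.exists_isKPSolution (h : IsFund l V c dc s ds) (hl : 0 < l) (a : ℝ) (z : ℂ)
    (y₀ p₀ : ℂ) : ∃ y p, IsKPSolution l V a z y p ∧ y 0 = y₀ ∧ p 0 0 = p₀ := by
  set M := fundMonodromy l a c dc s ds z with hM
  have hdet : IsUnit M.det := by rw [h.det_fundMonodromy]; exact isUnit_one
  -- `v k` is the state `(y'(k l +), y(k l))`; as `det M = 1`, integer powers propagate it in both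
  -- directions.
  set v : ℤ → Fin 2 → ℂ := fun k => (M ^ k).mulVec ![p₀, y₀] with hv
  have hv0 : v 0 = ![p₀, y₀] := by simp [hv]
  have hvs : ∀ k, v (k + 1) = M.mulVec (v k) := fun k => by
    simp only [hv]
    rw [add_comm, Matrix.zpow_one_add hdet, Matrix.mulVec_mulVec]
  have hv1 : ∀ k, v (k + 1) 1 = v k 1 * c z l + v k 0 * s z l := fun k => by
    rw [hvs, hM, fundMonodromy]
    simp [Matrix.mulVec, dotProduct, Fin.sum_univ_two]
    ring
  have hv2 : ∀ k, v (k + 1) 0 = v k 1 * dc z l + v k 0 * ds z l + a * v (k + 1) 1 := fun k => by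
    rw [hv1, hvs, hM, fundMonodromy]
    simp [Matrix.mulVec, dotProduct, Fin.sum_univ_two]
    ring
  set y : ℝ → ℂ := fun t => v ⌊t / l⌋ 1 * c z (t - ⌊t / l⌋ * l) +
    v ⌊t / l⌋ 0 * s z (t - ⌊t / l⌋ * l) with hy
  set p : ℤ → ℝ → ℂ := fun k t => v k 1 * dc z (t - k * l) + v k 0 * ds z (t - k * l) with hp
  have hyk : ∀ k : ℤ, y (k * l) = v k 1 := fun k => by
    simp [hy, hl.ne', h.c_zero, h.s_zero]
  have hycell : ∀ k : ℤ, EqOn y (fun t => v k 1 * c z (t - k * l) + v k 0 * s z (t - k * l))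
      (Icc (k * l) ((k + 1) * l)) := by
    intro k t ht
    rcases ht.2.lt_or_eq with hlt | heq
    · have hf : ⌊t / l⌋ = k := by
        rw [Int.floor_eq_iff, le_div_iff₀ hl, div_lt_iff₀ hl]
        exact ⟨ht.1, hlt⟩
      simp only [hy, hf]
    -- At the right end of the cell the floor is already `k + 1`; the value there matches by `hv1`,
    -- which is the continuity of `y`.
    · have h1 := hyk (k + 1)
      push_cast at h1
      simp only
      rw [heq, h1, hv1, show ((k : ℝ) + 1) * l - k * l = l by ring]
  refine ⟨y, p, ⟨fun k => ?_, fun k => ?_⟩, ?_, ?_⟩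
  · have h1 := (h.sol z (v k 1) (v k 0)).translate (k * l)
    rw [zero_add, show l + k * l = ((k : ℝ) + 1) * l by ring] at h1
    exact (h1.congr_potential fun t ht => (periodize_of_mem hl V k ht).symm).congr (hycell k)
  · have h2 := hv2 (k - 1)
    rw [sub_add_cancel] at h2
    rw [hyk]
    simp only [hp, sub_self, h.dc_zero, h.ds_zero, mul_zero, mul_one, zero_add]
    rw [h2]
    push_cast
    rw [show (k : ℝ) * l - (k - 1) * l = l by ring]
  · simpa [hv0] using hyk 0
  · simp [hp, h.dc_zero, h.ds_zero, hv0]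

theorem IsKPSolution.isSolution_zero (hl : 0 < l) {a : ℝ} {z : ℂ} {y : ℝ → ℂ} {p : ℤ → ℝ → ℂ}
    (h : IsKPSolution l V a z y p) : IsSolution 0 l V z y (p 0) := by
  have h1 := h.cell 0
  simp only [Int.cast_zero, zero_mul, zero_add, one_mul] at h1
  refine h1.congr_potential fun t ht => ?_
  rw [periodize_of_mem hl V 0 (by simpa using ht)]
  simp

theorem IsKPSolution.jump_one {a : ℝ} {z : ℂ} {y : ℝ → ℂ} {p : ℤ → ℝ → ℂ}
    (h : IsKPSolution l V a z y p) : p 1 l = p 0 l + a * y l := by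
  simpa using h.jump 1

theorem IsFund.isMonodromy (h : IsFund l V c dc s ds) (hl : 0 < l) (a : ℝ) (z : ℂ) :
    IsMonodromy l V a z (fundMonodromy l a c dc s ds z) := by
  refine ⟨?_, fun y₁ p₁ y₂ p₂ hf => ?_⟩
  · obtain ⟨y₁, p₁, h₁, h₁y, h₁p⟩ := h.exists_isKPSolution hl a z 0 1
    obtain ⟨y₂, p₂, h₂, h₂y, h₂p⟩ := h.exists_isKPSolution hl a z 1 0
    exact ⟨y₁, p₁, y₂, p₂, h₁, h₂, h₁y, h₁p, h₂y, h₂p⟩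
  · obtain ⟨e1, e2⟩ := h.rep z y₁ (p₁ 0) (hf.sol₁.isSolution_zero hl) l ⟨hl.le, le_rfl⟩
    obtain ⟨e3, e4⟩ := h.rep z y₂ (p₂ 0) (hf.sol₂.isSolution_zero hl) l ⟨hl.le, le_rfl⟩
    rw [hf.val₁, hf.der₁] at e1 e2
    rw [hf.val₂, hf.der₂] at e3 e4
    rw [hf.sol₁.jump_one, hf.sol₂.jump_one, e1, e2, e3, e4, fundMonodromy]
    simp

theorem IsMonodromy.unique {a : ℝ} {z : ℂ} {M N : Matrix (Fin 2) (Fin 2) ℂ}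
    (hM : IsMonodromy l V a z M) (hN : IsMonodromy l V a z N) : M = N := by
  obtain ⟨y₁, p₁, y₂, p₂, hf⟩ := hM.1
  rw [hM.2 _ _ _ _ hf, hN.2 _ _ _ _ hf]

theorem IsFund.isMonodromy_monodromy (h : IsFund l V c dc s ds) (hl : 0 < l) (a : ℝ) (z : ℂ) :
    IsMonodromy l V a z (monodromy l V a z) := by
  have hex : ∃ M, IsMonodromy l V a z M := ⟨_, h.isMonodromy hl a z⟩
  rw [monodromy, dif_pos hex]
  exact hex.choose_spec

theorem IsFund.discriminant_eq (h : IsFund l V c dc s ds) (hl : 0 < l) (a : ℝ) (z : ℂ) :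
    discriminant l V a z = ds z l + a * s z l + c z l := by
  rw [discriminant, (h.isMonodromy_monodromy hl a z).unique (h.isMonodromy hl a z), fundMonodromy,
    Matrix.trace_fin_two_of]

/-- The trace of the monodromy matrix lies in `[-2,2]` only for real `z`. -/
theorem IsFund.im_eq_zero_of_trace (h : IsFund l V c dc s ds) (a : ℝ) {z : ℂ} {d : ℝ}
    (hd : ds z l + a * s z l + c z l = d) (hd2 : |d| ≤ 2) : z.im = 0 := by
  have hsq : 0 ≤ 1 - d ^ 2 / 4 := by
    have := sq_le_sq' (abs_le.1 hd2).1 (abs_le.1 hd2).2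
    linarith
  set e := Real.sqrt (1 - d ^ 2 / 4) with he
  have hee : e ^ 2 = 1 - d ^ 2 / 4 := Real.sq_sqrt hsq
  -- A root of `ρ² - dρ + 1`, the characteristic polynomial of the monodromy matrix; it is
  -- unimodular because `|d| ≤ 2`.
  set ρ : ℂ := ⟨d / 2, e⟩ with hρ
  have hρ1 : ρ * starRingEnd ℂ ρ = 1 := by
    rw [Complex.mul_conj, Complex.normSq_mk, ← pow_two e, hee]
    push_cast
    ring
  have hρ2 : ρ ^ 2 - d * ρ + 1 = 0 := by
    have hsum : ρ + starRingEnd ℂ ρ = d := by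
      rw [Complex.add_conj]
      simp only [hρ]
      push_cast
      ring
    linear_combination ρ * hsum - hρ1
  obtain ⟨v, hv, hMv⟩ := Matrix.exists_mulVec_eq_zero_iff.2
    (show (!![ds z l + a * s z l - ρ, dc z l + a * c z l; s z l, c z l - ρ]).det = 0 by
      rw [Matrix.det_fin_two_of]
      linear_combination h.wronskian z - ρ * hd + hρ2)
  have e0 := congrFun hMv 0
  have e1 := congrFun hMv 1
  simp [Matrix.mulVec, dotProduct, Fin.sum_univ_two] at e0 e1
  -- The solution with initial state `v` has state `ρ v` at `l+`. The boundary form is the same at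
  -- `l-` and `l+` since `a` is real, and is unchanged by the factor `ρ` since `|ρ| = 1`.
  refine h.im_eq_zero z _ _ (h.sol z (v 1) (v 0)) ?_ ?_
  · simp only [h.c_zero, h.s_zero, h.dc_zero, h.ds_zero, mul_one, mul_zero, add_zero, zero_add]
    by_contra! hcon
    exact hv (funext fun i => by fin_cases i; exacts [hcon.2, hcon.1])
  · have hyl : v 1 * c z l + v 0 * s z l = ρ * v 1 := by linear_combination e1
    have hpl : v 1 * dc z l + v 0 * ds z l = ρ * v 0 - a * (ρ * v 1) := by
      linear_combination e0 - a * e1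
    simp only [h.c_zero, h.s_zero, h.dc_zero, h.ds_zero, mul_one, mul_zero, add_zero, zero_add]
    rw [hyl, hpl]
    simp only [map_sub, map_mul, Complex.conj_ofReal]
    linear_combination (v 1 * starRingEnd ℂ (v 0) - v 0 * starRingEnd ℂ (v 1)) * hρ1

theorem IsFund.isLyapunov (h : IsFund l V c dc s ds) (α β : ℝ) :
    IsLyapunov (2 * (1 + β ^ 2))
      (fun z => α * s z l + (1 + (β : ℂ) ^ 2) * (c z l + ds z l)) where
  differentiable := (h.differentiable_s.const_mul _).add
    ((h.differentiable_c.add h.differentiable_ds).const_mul _)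
  real x := by
    have : (1 + (β : ℂ) ^ 2) = ((1 + β ^ 2 : ℝ) : ℂ) := by push_cast; ring
    rw [this, Complex.add_im, Complex.im_ofReal_mul, Complex.im_ofReal_mul, Complex.add_im,
      h.real_s, h.real_c, h.real_ds]
    simp
  im_eq_zero z hz1 hz2 := by
    have hB : (0 : ℝ) < 1 + β ^ 2 := by positivity
    have hBC : (1 + (β : ℂ) ^ 2) ≠ 0 := by exact_mod_cast hB.ne'
    set η := α * s z l + (1 + (β : ℂ) ^ 2) * (c z l + ds z l) with hη
    have hηre : η = (η.re : ℂ) := Complex.ext rfl (by simpa using hz1)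
    refine h.im_eq_zero_of_trace (α / (1 + β ^ 2)) (d := η.re / (1 + β ^ 2)) ?_ ?_
    · push_cast
      rw [← hηre, hη]
      field_simp
      ring
    · rw [abs_div, abs_of_pos hB, div_le_iff₀ hB]
      exact hz2

theorem IsFund.re_mul_eq_one (h : IsFund l V c dc s ds) {x : ℝ} (hx : s x l = 0) :
    (c x l).re * (ds x l).re = 1 := by
  have hW := congrArg Complex.re (h.wronskian x)
  rw [hx, mul_zero, sub_zero, Complex.mul_re, h.real_c, zero_mul, sub_zero] at hW
  simpa using hW

end Monodromy

end KreinKP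

end

/-! ### Assembly of the theorem. -/

theorem mainTheorem5 (l : ℝ) (hl : 0 < l) (V : ℝ → ℝ)
    (hV : MeasureTheory.MemLp V 2 (MeasureTheory.volume.restrict (Set.Icc 0 l))) :
    -- the Krein matrix `s(z)` is well defined off `spec D`
    (∀ z ∉ KreinKP.spec (KreinKP.dirichletOp l V),
      KreinKP.IsKreinMatrix l V z (KreinKP.kreinMatrix l V z)) ∧
    -- (A)
    (∀ z ∉ KreinKP.spec (KreinKP.dirichletOp l V), KreinKP.kreinMatrix l V z 0 1 ≠ 0) ∧
    -- the eigenvalues `μ₀ < μ₁ < …` of `D`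
    ∃ μ : ℕ → ℝ, StrictMono μ ∧
      (∀ z : ℂ, KreinKP.IsEigenvalue (KreinKP.dirichletOp l V) z ↔ ∃ k, z = (μ k : ℂ)) ∧
      ∀ α β : ℝ, β ≠ 0 → ∃ η : ℂ → ℂ,
        -- (B)
        Differentiable ℂ η ∧
        (∀ z ∉ KreinKP.spec (KreinKP.dirichletOp l V), η z = KreinKP.kreinEta l V α β z) ∧
        -- (C)
        (∀ z : ℂ, KreinKP.IsMonodromy l V (α / (1 + β ^ 2)) z
          (KreinKP.monodromy l V (α / (1 + β ^ 2)) z)) ∧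
        (∀ z : ℂ, 1 / (1 + (β : ℂ) ^ 2) * η z =
          KreinKP.discriminant l V (α / (1 + β ^ 2)) z) ∧
        -- `η` is real on the real axis
        (∀ x : ℝ, (η x).im = 0) ∧
        -- (D)
        (∀ k, Even k → (η (μ k)).re ≤ -2 * (1 + β ^ 2)) ∧
        (∀ k, Odd k → 2 * (1 + β ^ 2) ≤ (η (μ k)).re) ∧
        -- (E)
        (∀ x : ℝ, |(η x).re| < 2 * (1 + β ^ 2) → deriv η x ≠ 0) ∧
        (∀ x : ℝ, IsLocalMin (fun t : ℝ => (η t).re) x → (η x).re ≠ 2 * (1 + β ^ 2)) ∧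
        (∀ x : ℝ, IsLocalMax (fun t : ℝ => (η t).re) x → (η x).re ≠ -2 * (1 + β ^ 2)) := by
  obtain ⟨c, dc, s, ds, h, μ, hmono, hzero, heven, hodd⟩ := KreinKP.exists_isFund hl hV
  have hsμ : ∀ k, s (μ k) l = 0 := fun k => (hzero _).2 ⟨k, rfl⟩
  refine ⟨fun z hz => h.isKreinMatrix_kreinMatrix hl (h.ne_zero_of_notMem_spec hl hz),
    fun z hz => ?_, μ, hmono, fun z => (h.isEigenvalue_iff hl z).trans (hzero z),
    fun α β _ => ?_⟩
  · have hs := h.ne_zero_of_notMem_spec hl hz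
    rw [h.kreinMatrix_eq hl hs]
    simpa using hs
  have hB : (0 : ℝ) < 1 + β ^ 2 := by positivity
  have hBC : (1 + (β : ℂ) ^ 2) ≠ 0 := by exact_mod_cast hB.ne'
  have hL := h.isLyapunov α β
  have hημ : ∀ k, ((α : ℂ) * s (μ k) l + (1 + (β : ℂ) ^ 2) * (c (μ k) l + ds (μ k) l)).re =
      (1 + β ^ 2) * ((c (μ k) l).re + (ds (μ k) l).re) := fun k => by
    rw [hsμ k, mul_zero, zero_add,
      show (1 + (β : ℂ) ^ 2) = ((1 + β ^ 2 : ℝ) : ℂ) by push_cast; ring,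
      Complex.re_ofReal_mul, Complex.add_re]
  refine ⟨_, hL.differentiable, fun z hz => ?_, fun z => h.isMonodromy_monodromy hl _ z,
    fun z => ?_, hL.real, fun k hk => ?_, fun k hk => ?_, fun x hx => hL.deriv_ne_zero hx,
    fun x hx => hL.ne_of_isLocalMin (by positivity) hx, fun x hx => ?_⟩
  · exact (h.kreinEta_eq hl α β (h.ne_zero_of_notMem_spec hl hz)).symm
  · rw [h.discriminant_eq hl]
    push_cast
    field_simp
    ring
  · rw [hημ]
    have h1 := h.re_mul_eq_one (hsμ k)
    have h2 := heven k hk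
    -- Write `d` for `(ds (μ k) l).re < 0`, so that `c d = 1`. If `c + d > -2`, multiplying by `d`
    -- gives `(d + 1)² < 0`.
    have h3 : (c (μ k) l).re + (ds (μ k) l).re ≤ -2 := by
      by_contra hcon
      nlinarith [sq_nonneg ((ds (μ k) l).re + 1), mul_neg_of_neg_of_pos h2 (by linarith :
        0 < (c (μ k) l).re + (ds (μ k) l).re + 2)]
    nlinarith
  · rw [hημ]
    have h1 := h.re_mul_eq_one (hsμ k)
    have h2 := hodd k hk
    have h3 : 2 ≤ (c (μ k) l).re + (ds (μ k) l).re := by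
      by_contra hcon
      nlinarith [sq_nonneg ((ds (μ k) l).re - 1), mul_pos h2 (by linarith :
        0 < 2 - ((c (μ k) l).re + (ds (μ k) l).re))]
    nlinarith
  · have := hL.ne_of_isLocalMax (by positivity) hx
    rwa [neg_mul]
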